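/- Fix $\bar\epsilon\in(0,1)$. A state $\omega$ is uniform on $[-1,1]$. Exactly one of two speakers is the expert, who observes $\omega$; the other is the quack, who observes nothing. Both speakers know who is the expert; the judge believes that speaker $i$ is the expert with probability $p_i\in(0,1)$, independently of $\omega$, where $p_1+p_2=1$. The speakers simultaneously send messages $m_1,m_2\in[-1,1]$; the judge observes $(m_1,m_2)$ and $s=\omega+\epsilon$, with $\epsilon\sim\mathcal U[-\bar\epsilon,\bar\epsilon]$ independent of everything else, and selects one speaker. The judge gets $1$ if she selects the expert and $0$ otherwise; a speaker gets $1$ if he is selected and $0$ otherwise. A strategy profile consists of, for each speaker $i$, a transition kernel $F^i_E(\cdot\mid\omega)$ on $[-1,1]$ (the message when $i$ is the expert) and a distribution $F^i_Q$ on $[-1,1]$ (the message when $i$ is the quack), together with a measurable selection rule $\phi(m_1,m_2,s)\in\Delta\{1,2\}$. It is a perfect Bayesian equilibrium if $F^i_E(\cdot\mid\omega)$, for every $\omega$, and $F^i_Q$ maximize the respective speaker's probability of being selected, and if there are beliefs about who is the expert given $(m_1,m_2,s)$ that are consistent with Bayes' rule (a version of the conditional probability) and such that $\phi(m_1,m_2,s)$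 is, for every $(m_1,m_2,s)$, supported on the speaker(s) most likely to be the expert. Suppose $p_1>1/2>p_2$ (speaker 1 is favored, speaker 2 disfavored), and let $$\bar m=\max\{p_2/p_1,\ 1-2\bar\epsilon\}.$$ Then $0<\bar m$ and $\bar m\in[1-2\bar\epsilon,1]$, and there is a perfect Bayesian equilibrium in which 1. the expert reports the state truthfully: $F^i_E(\cdot\mid\omega)=\delta_\omega$ for $i=1,2$ and all $\omega\in[-1,1]$; 2. the disfavored quack randomizes uniformly over all messages: $F^2_Q=\mathcal U[-1,1]$; 3. the favored quack randomizes uniformly over $[-\bar m,\bar m]$: $F^1_Q=\mathcal U[-\bar m,\bar m]$. Moreover $\bar m=p_2/p_1$ whenever $p_1\le 1/(2-2\bar\epsilon)$, and $\bar m=1-2\bar\epsilon$ if and only if $p_1\ge 1/(2-2\bar\epsilon)$. -/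

import Mathlib

open MeasureTheory ProbabilityTheory
open scoped ENNReal

namespace QuackGame

/-- The interval `[-1, 1]`: it is both the set of states and the message space. -/
abbrev Msg : Type := Set.Icc (-1 : ℝ) 1

/-- The two speakers are indexed by `Fin 2`: speaker 1 is `0`, speaker 2 is `1`. -/
def other (i : Fin 2) : Fin 2 := if i = 0 then 1 else 0

/-- The message pair `(m₁, m₂)` in which speaker `i` sends `own` and the other speaker `opp`. -/
def arrange (i : Fin 2) (own opp : Msg) : Msg × Msg := if i = 0 then (own, opp) else (opp, own)

/-- The uniform distribution on `[-c, c]`, as a distribution on `[-1, 1]` (used for `0 < c ≤ 1`). -/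
noncomputable def uniformMsg (c : ℝ) : Measure Msg :=
  ProbabilityTheory.cond ((volume : Measure ℝ).comap ((↑) : Msg → ℝ)) {m | |(m : ℝ)| ≤ c}

/-- The state of the world is uniform on `[-1, 1]`. -/
noncomputable def stateLaw : Measure Msg := uniformMsg 1

/-- The noise in the judge's signal is uniform on `[-ε, ε]`. -/
noncomputable def noiseLaw (ε : ℝ) : Measure ℝ :=
  ProbabilityTheory.cond (volume : Measure ℝ) (Set.Icc (-ε) ε)

/-- Messaging strategies: `expert i ω` is the distribution of the message of speaker `i` when he is
the expert and has observed the state `ω`; `quack i` is the distribution of the message of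
speaker `i` when he is the quack. -/
structure Messaging where
  expert : Fin 2 → Kernel Msg Msg
  quack : Fin 2 → Measure Msg
  expert_markov : ∀ i, IsMarkovKernel (expert i)
  quack_prob : ∀ i, IsProbabilityMeasure (quack i)

/-- A measurable assignment of a probability distribution on the two speakers to each triple
`(m₁, m₂, s)` of messages and judge's signal; `first x` is the probability of speaker 1.
Both selection rules and belief systems of the judge have this form. -/
structure SpeakerRule where
  first : (Msg × Msg) × ℝ → ℝ
  measurable_first : Measurable first
  first_nonneg : ∀ x, 0 ≤ first x
  first_le_one : ∀ x, first x ≤ 1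

/-- The probability that a rule assigns to speaker `i`. -/
def SpeakerRule.prob (φ : SpeakerRule) (i : Fin 2) (x : (Msg × Msg) × ℝ) : ℝ :=
  if i = 0 then φ.first x else 1 - φ.first x

/-- The probability that speaker `i` is selected if he is the expert, the state is `ω`, he sends
the message `m`, and the other speaker (the quack) follows his strategy. -/
noncomputable def expertPayoff (ε : ℝ) (σ : Messaging) (φ : SpeakerRule) (i : Fin 2)
    (ω m : Msg) : ℝ :=
  ∫ e, ∫ m', φ.prob i (arrange i m m', (ω : ℝ) + e) ∂(σ.quack (other i)) ∂(noiseLaw ε)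

/-- The probability that speaker `i` is selected if he is the quack, sends the message `m`, and the
other speaker (the expert) follows his strategy. -/
noncomputable def quackPayoff (ε : ℝ) (σ : Messaging) (φ : SpeakerRule) (i : Fin 2)
    (m : Msg) : ℝ :=
  ∫ ω, ∫ e, ∫ m', φ.prob i (arrange i m m', (ω : ℝ) + e) ∂(σ.expert (other i) ω)
    ∂(noiseLaw ε) ∂stateLaw

/-- The joint law of `((m₁, m₂), s)` conditional on speaker `i` being the expert. -/
noncomputable def outcomeLaw (ε : ℝ) (σ : Messaging) (i : Fin 2) : Measure ((Msg × Msg) × ℝ) :=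
  (((stateLaw ⊗ₘ σ.expert i).prod (σ.quack (other i))).prod (noiseLaw ε)).map
    fun x => (arrange i x.1.1.2 x.1.2, (x.1.1.1 : ℝ) + x.2)

/-- Bayes consistency: `β` is a version of the conditional probability, given `((m₁, m₂), s)`, that
the respective speaker is the expert, where `p i` is the prior probability that speaker `i` is the
expert. -/
def BayesConsistent (ε : ℝ) (p : Fin 2 → ℝ) (σ : Messaging) (β : SpeakerRule) : Prop :=
  ∀ i, ∀ B : Set ((Msg × Msg) × ℝ), MeasurableSet B →
    ENNReal.ofReal (p i) * outcomeLaw ε σ i B =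
      ∫⁻ x in B, ENNReal.ofReal (β.prob i x)
        ∂(ENNReal.ofReal (p 0) • outcomeLaw ε σ 0 + ENNReal.ofReal (p 1) • outcomeLaw ε σ 1)

/-- Perfect Bayesian equilibrium, for noise parameter `ε` and prior probabilities `p i` that
speaker `i` is the expert (and the other speaker the quack): messaging strategies `σ`, a selection
rule `φ` and a belief system `β` such that the expert's strategy is optimal in every state, the
quack's strategy is optimal, beliefs are Bayes consistent, and after every triple `(m₁, m₂, s)` only
speakers that are most likely to be the expert are selected with positive probability. -/
structure IsPBE (ε : ℝ) (p : Fin 2 → ℝ) (σ : Messaging) (φ β : SpeakerRule) : Prop where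
  expert_optimal : ∀ (i : Fin 2) (ω m : Msg),
    expertPayoff ε σ φ i ω m ≤ ∫ m', expertPayoff ε σ φ i ω m' ∂(σ.expert i ω)
  quack_optimal : ∀ (i : Fin 2) (m : Msg),
    quackPayoff ε σ φ i m ≤ ∫ m', quackPayoff ε σ φ i m' ∂(σ.quack i)
  bayes : BayesConsistent ε p σ β
  judge_optimal : ∀ (x : (Msg × Msg) × ℝ) (i : Fin 2), 0 < φ.prob i x →
    ∀ j : Fin 2, β.prob j x ≤ β.prob i x

end QuackGame

namespace QuackGame

/-! The equilibrium is explicit. Write `u`, `v` for the messages of speakers 1 and 2 and `b` for the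
radius of the favored quack's support. Speaker 1 loses if `u` is farther than `ε` from the signal,
and wins if only `u` is within `ε`. The sole freedom is the probability `share` of selecting speaker
2 when both are consistent. Integrated over signals it becomes `transport = share * tent`, and the
incentives reduce to conditions on this plan: it lies between `0` and `tent`; its integral over `v`
is `overlap ε u - overlap ε b` for `|u| ≤ b`, and it vanishes for larger `|u|` (quack 1 is
indifferent on `[-b, b]` and gains nothing outside); its integral over `u` does not depend on `v`
(quack 2 is indifferent). Truth-telling by the experts follows from the same conditions
(`expertGain_le`, `expertGain'_le`).

To build such a plan, note that `overlap ε u - overlap ε b` is the integral of `layer ε τ` over `|u|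
≤ τ ≤ b`, a superposition of the indicators of `[-τ, τ]`. In layer `τ`, send fractions `(τ + u) / 2`
and `(τ - u) / 2` of the unit mass at `u` to `u + (1 - τ)` and `u - (1 - τ)`, and spread the
remaining `1 - τ` uniformly between these two points. The image has constant density `τ` on `[-1,
1]`. No displacement exceeds `1 - τ`, and `layer ε τ ≤ tent ε (1 - τ)`, so the plan fits under
`tent`.

For the judge, when both messages are consistent and `|u| ≤ b`, the odds of speaker 1 are `p₁ : p₂ /
b`. If `b = p₂ / p₁` this is a tie and any `share` is optimal. If `b = 1 - 2 * ε` the layers up to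
`b` vanish, so `share = 0`, which is optimal because `p₂ / b ≤ p₁`. -/

/-! ### The transport plan and its pointwise bounds -/

/-- The length of the overlap of the windows of radius `ε` around two points at distance `|t|`. -/
noncomputable def tent (ε t : ℝ) : ℝ := max (2 * ε - |t|) 0

/-- The rate at which the overlap of a window around `τ` with the state space decreases in `τ`. -/
noncomputable def layer (ε τ : ℝ) : ℝ := tent ε (1 - τ) - tent ε (1 + τ)

/-- The part of the transport plan that moves each layer `[-τ, τ]` to the right by `1 - τ`. -/
noncomputable def jump (ε b u v : ℝ) : ℝ :=
  if 1 - v + u ≤ b then layer ε (1 - v + u) * max (1 - v + 2 * u) 0 / 2 else 0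

/-- The part of the transport plan that spreads each layer `[-τ, τ]` by a uniform displacement of
size at most `1 - τ`. -/
noncomputable def spread (ε b u v : ℝ) : ℝ :=
  ∫ τ in Set.Icc 0 b, layer ε τ / 2 * (if |u| ≤ τ ∧ |v - u| ≤ 1 - τ then 1 else 0)

/-- A transport plan from a measure on `[-b, b]` to a multiple of Lebesgue measure on `[-1, 1]`
whose density is at most `tent`. -/
noncomputable def transport (ε b u v : ℝ) : ℝ :=
  jump ε b u v + jump ε b (-u) (-v) + spread ε b u v

/-- The total overlap of the window around `u` with the windows around the states. -/
noncomputable def overlap (ε u : ℝ) : ℝ := ∫ v in Set.Icc (-1 : ℝ) 1, tent ε (u - v)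

lemma tent_nonneg (ε t : ℝ) : 0 ≤ tent ε t := le_max_right _ _

lemma tent_neg (ε t : ℝ) : tent ε (-t) = tent ε t := by simp [tent]

lemma tent_le_of_abs_le {ε s t : ℝ} (h : |s| ≤ |t|) : tent ε t ≤ tent ε s :=
  max_le_max (by linarith) le_rfl

lemma continuous_tent (ε : ℝ) : Continuous (tent ε) := by unfold tent; fun_prop

lemma continuous_layer (ε : ℝ) : Continuous (layer ε) := by unfold layer tent; fun_prop

lemma layer_nonneg {ε τ : ℝ} (h : 0 ≤ τ) : 0 ≤ layer ε τ := by
  refine sub_nonneg.2 (tent_le_of_abs_le ?_)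
  rw [abs_of_nonneg (by linarith : 0 ≤ 1 + τ), abs_le]
  constructor <;> linarith

lemma layer_le (ε τ : ℝ) : layer ε τ ≤ tent ε (1 - τ) :=
  sub_le_self _ (tent_nonneg _ _)

lemma jump_nonneg (ε b u v : ℝ) (hv : v ≤ 1) : 0 ≤ jump ε b u v := by
  unfold jump
  split_ifs with h
  · rcases le_or_gt (1 - v + 2 * u) 0 with h0 | h0
    · simp [max_eq_right h0]
    · have : 0 ≤ layer ε (1 - v + u) := layer_nonneg (by linarith)
      positivity
  · rfl

lemma jump_eq_zero (ε : ℝ) {b u v : ℝ} (hv : v ≤ 1) (hu : b < |u|) : jump ε b u v = 0 := by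
  unfold jump
  split_ifs with h
  · rw [max_eq_right, mul_zero, zero_div]
    rcases lt_abs.1 hu with h1 | h1 <;> linarith
  · rfl

lemma jump_le {ε b u v : ℝ} :
    jump ε b u v ≤ if 1 - v + u ≤ b then tent ε (v - u) * (max (1 - v + 2 * u) 0 / 2) else 0 := by
  unfold jump
  split_ifs with h
  · rw [mul_div_assoc]
    refine mul_le_mul_of_nonneg_right ?_ (by positivity)
    have := layer_le ε (1 - v + u)
    rwa [show 1 - (1 - v + u) = v - u by ring] at this
  · rfl

lemma spread_nonneg (ε b u v : ℝ) : 0 ≤ spread ε b u v := by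
  refine setIntegral_nonneg measurableSet_Icc fun τ hτ => ?_
  have := layer_nonneg (ε := ε) hτ.1
  split_ifs <;> simp
  linarith

lemma measurable_spread_integrand (ε : ℝ) :
    Measurable fun x : (ℝ × ℝ) × ℝ =>
      layer ε x.2 / 2 * (if |x.1.1| ≤ x.2 ∧ |x.1.2 - x.1.1| ≤ 1 - x.2 then (1 : ℝ) else 0) := by
  have := (continuous_layer ε).measurable
  have h1 : MeasurableSet {x : (ℝ × ℝ) × ℝ | |x.1.1| ≤ x.2} :=
    measurableSet_le (by fun_prop) (by fun_prop)
  have h2 : MeasurableSet {x : (ℝ × ℝ) × ℝ | |x.1.2 - x.1.1| ≤ 1 - x.2} :=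
    measurableSet_le (by fun_prop) (by fun_prop)
  exact Measurable.mul (by fun_prop)
    (Measurable.ite (h1.inter h2) measurable_const measurable_const)

lemma abs_layer_le (ε τ : ℝ) (hε : 0 < ε) : |layer ε τ| ≤ 2 * ε := by
  have h : ∀ t, tent ε t ≤ 2 * ε := fun t => max_le (by linarith [abs_nonneg t]) (by linarith)
  rw [abs_le]
  constructor <;> unfold layer <;>
    linarith [h (1 - τ), h (1 + τ), tent_nonneg ε (1 - τ), tent_nonneg ε (1 + τ)]

lemma abs_spread_integrand_le {ε : ℝ} (hε : 0 < ε) (τ : ℝ) (p : Prop) [Decidable p] :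
    ‖layer ε τ / 2 * (if p then (1 : ℝ) else 0)‖ ≤ ε := by
  have := abs_layer_le ε τ hε
  rw [Real.norm_eq_abs]
  split_ifs
  · rw [mul_one, abs_div, abs_two]; linarith
  · simp [hε.le]

/-- Only layers with `|u| ≤ τ ≤ min b (1 - |v - u|)` reach from `u` to `v`, and each contributes at
most `tent ε (v - u) / 2`, because `tent` decreases with distance. -/
lemma spread_le {ε b u v : ℝ} (hε : 0 < ε) :
    spread ε b u v ≤ tent ε (v - u) / 2 * max (min b (1 - |v - u|) - |u|) 0 := by
  have hm := (measurable_spread_integrand ε).comp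
    (measurable_prodMk_left (x := (u, v)))
  have key : spread ε b u v ≤ ∫ τ in Set.Icc 0 b,
      (Set.Icc |u| (min b (1 - |v - u|))).indicator (fun _ => tent ε (v - u) / 2) τ := by
    refine setIntegral_mono_on ?_ ?_ measurableSet_Icc fun τ hτ => ?_
    · refine Integrable.of_bound hm.aestronglyMeasurable ε (.of_forall fun τ => ?_)
      exact abs_spread_integrand_le hε _ _
    · exact (integrable_const _).indicator measurableSet_Icc
    · by_cases h : |u| ≤ τ ∧ |v - u| ≤ 1 - τ
      · rw [if_pos h, Set.indicator_of_mem (show τ ∈ Set.Icc _ _ from ⟨h.1, le_min hτ.2 (by linarith [h.2])⟩), mul_one]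
        have h1 := layer_le ε τ
        have h2 : tent ε (1 - τ) ≤ tent ε (v - u) :=
          tent_le_of_abs_le (by rw [abs_of_nonneg ((abs_nonneg _).trans h.2)]; exact h.2)
        linarith
      · rw [if_neg h, mul_zero]
        exact Set.indicator_nonneg (fun _ _ => div_nonneg (tent_nonneg _ _) two_pos.le) _
  refine key.trans_eq ?_
  rw [setIntegral_indicator measurableSet_Icc, setIntegral_const, smul_eq_mul, mul_comm]
  congr 1
  rw [Set.inter_eq_self_of_subset_right, Real.volume_real_Icc]
  exact Set.Icc_subset_Icc (abs_nonneg _) (min_le_left _ _)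

lemma transport_nonneg (ε b : ℝ) {u v : ℝ} (hv : |v| ≤ 1) : 0 ≤ transport ε b u v := by
  have := jump_nonneg ε b u v (abs_le.1 hv).2
  have := jump_nonneg ε b (-u) (-v) (by linarith [(abs_le.1 hv).1])
  have := spread_nonneg ε b u v
  unfold transport
  linarith

/-- This makes `share` a probability. For `u ≤ v` put `τ = 1 - (v - u)`. If `τ ≤ b`, the jump and
the spread use at most the fractions `(τ + u)⁺ / 2` and `(τ - |u|)⁺ / 2` of `tent`, which add up to
at most `1`. -/
lemma transport_le {ε b u v : ℝ} (hε : 0 < ε) (hb : b < 1) (hu : |u| ≤ 1) (hv : |v| ≤ 1) :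
    transport ε b u v ≤ tent ε (u - v) := by
  -- The plan is invariant under `(u, v) ↦ (-u, -v)`. Once `u ≤ v`, the leftward jump is absent
  -- since its layer index `1 + v - u` exceeds `b`.
  wlog huv : u ≤ v generalizing u v
  · have := this (u := -u) (v := -v) (by simpa) (by simpa) (by linarith)
    have e : spread ε b (-u) (-v) = spread ε b u v := by
      unfold spread
      simp only [abs_neg, show -v - -u = -(v - u) by ring]
    unfold transport at this ⊢
    rw [neg_neg, neg_neg, e, ← tent_neg] at this
    rw [show u - v = -(-u - -v) by ring]
    linarith
  have h1 := jump_le (ε := ε) (u := u) (v := v) (b := b)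
  have h2 : jump ε b (-u) (-v) = 0 := by
    unfold jump
    rw [if_neg (by linarith)]
  have h3 := spread_le (b := b) (u := u) (v := v) hε
  have ht := tent_nonneg ε (v - u)
  rw [show u - v = -(v - u) by ring, tent_neg]
  unfold transport
  rw [h2]
  rw [abs_le] at hu hv
  rw [abs_of_nonneg (by linarith : 0 ≤ v - u)] at h3
  have hu' := le_abs_self u
  have hu'' := neg_abs_le u
  have h0 := abs_nonneg u
  split_ifs at h1 with h
  · have : max (1 - v + 2 * u) 0 / 2 + max (min b (1 - (v - u)) - |u|) 0 / 2 ≤ 1 := by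
      rw [min_eq_right (by linarith)]
      rcases max_cases (1 - v + 2 * u) 0 with ⟨h4, _⟩ | ⟨h4, _⟩ <;>
      rcases max_cases (1 - (v - u) - |u|) 0 with ⟨h5, _⟩ | ⟨h5, _⟩ <;> rw [h4, h5] <;>
      rcases abs_cases u with ⟨h6, _⟩ | ⟨h6, _⟩ <;> linarith
    nlinarith
  · have : max (min b (1 - (v - u)) - |u|) 0 ≤ 1 :=
      max_le (by linarith [min_le_left b (1 - (v - u))]) zero_le_one
    nlinarith

lemma transport_eq_zero_of_lt (ε : ℝ) {b u v : ℝ} (hv : |v| ≤ 1) (hu : b < |u|) :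
    transport ε b u v = 0 := by
  rw [abs_le] at hv
  have h : spread ε b u v = 0 := by
    refine setIntegral_eq_zero_of_forall_eq_zero fun τ hτ => ?_
    rw [if_neg (fun h => by linarith [h.1, hτ.2]), mul_zero]
  unfold transport
  rw [jump_eq_zero ε hv.2 hu, jump_eq_zero ε (by linarith) (by rwa [abs_neg]), h]
  simp

/-- For `τ ≤ 1 - 2 * ε` the windows at distance `1 - τ` do not overlap in positive length, so every
layer used has zero weight. -/
lemma transport_eq_zero {ε b : ℝ} (hb : b ≤ 1 - 2 * ε) (hb0 : b < 1) {u v : ℝ} (hv : |v| ≤ 1) :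
    transport ε b u v = 0 := by
  have hl : ∀ τ, 0 ≤ τ → τ ≤ b → layer ε τ = 0 := fun τ h0 h => by
    refine le_antisymm ((layer_le ε τ).trans (max_le ?_ le_rfl)) (layer_nonneg h0)
    rw [abs_of_nonneg (by linarith)]
    linarith
  have hj : ∀ u v, v ≤ 1 → jump ε b u v = 0 := fun u v hv => by
    unfold jump
    split_ifs with h
    · rcases le_or_gt (1 - v + 2 * u) 0 with h0 | h0
      · simp [max_eq_right h0]
      · rw [hl _ (by linarith) h]; simp
    · rfl
  have h : spread ε b u v = 0 := by
    refine setIntegral_eq_zero_of_forall_eq_zero fun τ hτ => ?_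
    rw [hl τ hτ.1 hτ.2]; simp
  rw [abs_le] at hv
  unfold transport
  rw [hj _ _ hv.2, hj _ _ (by linarith), h]
  simp

/-! ### Measurability and marginals of the transport plan -/

lemma measurable_jump (ε b : ℝ) : Measurable fun x : ℝ × ℝ => jump ε b x.1 x.2 := by
  have := (continuous_layer ε).measurable
  unfold jump
  exact Measurable.ite (measurableSet_le (by fun_prop) (by fun_prop)) (by fun_prop) (by fun_prop)

lemma measurable_spread (ε b : ℝ) : Measurable fun x : ℝ × ℝ => spread ε b x.1 x.2 :=
  (StronglyMeasurable.integral_prod_right (ν := volume.restrict (Set.Icc 0 b))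
    (measurable_spread_integrand ε).stronglyMeasurable).measurable

lemma measurable_transport (ε b : ℝ) : Measurable fun x : ℝ × ℝ => transport ε b x.1 x.2 :=
  ((measurable_jump ε b).add ((measurable_jump ε b).comp measurable_neg)).add
    (measurable_spread ε b)

/-- `overlap ε u` integrates `tent` over `[u - 1, u + 1]`, so its derivative in `u` is `-layer ε u`.
-/
lemma overlap_sub_overlap (ε u u' : ℝ) : overlap ε u - overlap ε u' = ∫ τ in u..u', layer ε τ := by
  have h : ∀ u, overlap ε u = ∫ t in (u - 1)..(u + 1), tent ε t := fun u => by
    unfold overlap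
    rw [integral_Icc_eq_integral_Ioc, ← intervalIntegral.integral_of_le (by norm_num),
      intervalIntegral.integral_comp_sub_left (tent ε)]
    simp
  have hi : ∀ x y, IntervalIntegrable (tent ε) volume x y :=
    fun x y => (continuous_tent ε).intervalIntegrable x y
  have hc := continuous_tent ε
  rw [h, h, intervalIntegral.integral_interval_sub_interval_comm (hi _ _) (hi _ _) (hi _ _)]
  unfold layer
  rw [intervalIntegral.integral_sub ((by fun_prop : Continuous _).intervalIntegrable _ _)
    ((by fun_prop : Continuous _).intervalIntegrable _ _)]
  rw [intervalIntegral.integral_comp_add_left (tent ε)]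
  have : ∀ τ, tent ε (1 - τ) = tent ε (τ - 1) := fun τ => by rw [← tent_neg]; ring_nf
  simp_rw [this]
  rw [intervalIntegral.integral_comp_sub_right (tent ε)]
  simp only [add_comm]

lemma overlap_neg (ε u : ℝ) : overlap ε (-u) = overlap ε u := by
  unfold overlap
  rw [integral_Icc_eq_integral_Ioc, integral_Icc_eq_integral_Ioc,
    ← intervalIntegral.integral_of_le (by norm_num),
    ← intervalIntegral.integral_of_le (by norm_num)]
  have := intervalIntegral.integral_comp_neg (fun v => tent ε (u - v)) (a := -1) (b := 1)
  rw [neg_neg] at this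
  rw [← this]
  congr 1 with v
  rw [← tent_neg]
  ring_nf

lemma overlap_abs (ε u : ℝ) : overlap ε |u| = overlap ε u := by
  rcases abs_choice u with h | h <;> rw [h]
  exact overlap_neg ε u

lemma overlap_le {ε b u : ℝ} (hb : 0 ≤ b) (hu : b ≤ |u|) : overlap ε u ≤ overlap ε b := by
  rw [← overlap_abs ε u, ← sub_nonneg, overlap_sub_overlap]
  exact intervalIntegral.integral_nonneg hu fun τ hτ => layer_nonneg (hb.trans hτ.1)

lemma integral_jump_right (ε : ℝ) {b u : ℝ} (hb : b < 1) (hu : |u| ≤ b) :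
    ∫ v in Set.Icc (-1 : ℝ) 1, jump ε b u v =
      ∫ τ in Set.Icc 0 b, layer ε τ * (if |u| ≤ τ then (τ + u) / 2 else 0) := by
  -- Substitute `v = 1 + u - τ`: the layer index becomes the variable of integration.
  rw [← integral_indicator measurableSet_Icc, ← integral_indicator measurableSet_Icc,
    ← integral_sub_left_eq_self _ volume (1 + u)]
  congr 1 with τ
  have h1 := le_abs_self u
  have h2 := neg_abs_le u
  have h3 := abs_nonneg u
  simp only [Set.indicator_apply, Set.mem_Icc, jump]
  rw [show 1 - (1 + u - τ) + u = τ by ring, show 1 - (1 + u - τ) + 2 * u = τ + u by ring]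
  by_cases hτ : |u| ≤ τ ∧ τ ≤ b
  · rw [if_pos ⟨by linarith, by linarith⟩, if_pos hτ.2, if_pos ⟨by linarith, hτ.2⟩, if_pos hτ.1,
      max_eq_left (by linarith)]
    ring
  · have hr : (if 0 ≤ τ ∧ τ ≤ b then layer ε τ * (if |u| ≤ τ then (τ + u) / 2 else 0) else 0)
        = 0 := by
      by_cases h : |u| ≤ τ <;> by_cases h' : τ ≤ b <;> simp_all
    rw [hr]
    split_ifs with h h' <;> try rfl
    rw [max_eq_right, mul_zero, zero_div]
    by_contra! h0
    refine hτ ⟨abs_le.2 ⟨by linarith, by linarith [h.2]⟩, h'⟩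

lemma integral_jump_left (ε : ℝ) {b v : ℝ} (hb : b < 1) (hv : |v| ≤ 1) :
    ∫ u in Set.Icc (-1 : ℝ) 1, jump ε b u v =
      ∫ τ in Set.Icc 0 b, layer ε τ * (max (2 * τ - 1 + v) 0 / 2) := by
  -- Substitute `u = τ - (1 - v)`, the point of layer `τ` that jumps right onto `v`.
  rw [← integral_indicator measurableSet_Icc, ← integral_indicator measurableSet_Icc,
    ← integral_sub_right_eq_self _ (1 - v)]
  congr 1 with τ
  rw [abs_le] at hv
  simp only [Set.indicator_apply, Set.mem_Icc, jump]
  rw [show 1 - v + (τ - (1 - v)) = τ by ring,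
    show 1 - v + 2 * (τ - (1 - v)) = 2 * τ - 1 + v by ring]
  rcases le_or_gt (2 * τ - 1 + v) 0 with h | h
  · simp [max_eq_right h]
  · by_cases hτ : τ ≤ b
    · rw [if_pos ⟨by linarith, by linarith⟩, if_pos hτ, if_pos ⟨by linarith, hτ⟩]
      ring
    · simp [hτ]

lemma integral_neg_Icc (f : ℝ → ℝ) (c : ℝ) :
    ∫ x in Set.Icc (-c) c, f (-x) = ∫ x in Set.Icc (-c) c, f x := by
  rw [← integral_indicator measurableSet_Icc, ← integral_indicator measurableSet_Icc,
    ← integral_neg_eq_self]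
  congr 1 with x
  simp only [Set.indicator_apply, Set.mem_Icc, neg_neg]
  congr 1
  simp only [eq_iff_iff]
  constructor <;> rintro ⟨h, h'⟩ <;> constructor <;> linarith

lemma integral_swap_of_bound {μ ν : Measure ℝ} [IsFiniteMeasure μ] [IsFiniteMeasure ν]
    {f : ℝ → ℝ → ℝ} (hf : Measurable (Function.uncurry f)) (C : ℝ) (hC : ∀ x y, ‖f x y‖ ≤ C) :
    ∫ x, ∫ y, f x y ∂ν ∂μ = ∫ y, ∫ x, f x y ∂μ ∂ν :=
  integral_integral_swap (Integrable.of_bound hf.aestronglyMeasurable C (.of_forall fun _ => hC _ _))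

lemma integral_add_add {μ : Measure ℝ} {f g h : ℝ → ℝ} (hf : Integrable f μ) (hg : Integrable g μ)
    (hh : Integrable h μ) :
    ∫ x, f x + g x + h x ∂μ = ∫ x, f x ∂μ + ∫ x, g x ∂μ + ∫ x, h x ∂μ := by
  rw [← integral_add hf hg]
  exact integral_add (hf.add hg) hh

lemma integral_indicator_Icc {s : Set ℝ} {x y c d : ℝ} {p : ℝ → Prop} [DecidablePred p]
    (hs : s = Set.Icc x y) (h : ∀ t, t ∈ s ∧ p t ↔ t ∈ Set.Icc c d) :
    ∫ t in s, (if p t then (1 : ℝ) else 0) = max (d - c) 0 := by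
  rw [← integral_indicator (hs ▸ measurableSet_Icc)]
  have : (s.indicator fun t => if p t then (1 : ℝ) else 0) = (Set.Icc c d).indicator 1 := by
    ext t
    have := h t
    by_cases h1 : t ∈ s <;> by_cases h2 : p t <;> simp_all
  rw [this, integral_indicator_one measurableSet_Icc, Real.volume_real_Icc]

lemma integral_spread_right {ε b u : ℝ} (hε : 0 < ε) (hb : b < 1) :
    ∫ v in Set.Icc (-1 : ℝ) 1, spread ε b u v =
      ∫ τ in Set.Icc 0 b, layer ε τ * (if |u| ≤ τ then 1 - τ else 0) := by
  unfold spread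
  rw [integral_swap_of_bound (f := fun v τ =>
      layer ε τ / 2 * (if |u| ≤ τ ∧ |v - u| ≤ 1 - τ then (1 : ℝ) else 0))
    ((measurable_spread_integrand ε).comp (f := fun x : ℝ × ℝ => ((u, x.1), x.2)) (by fun_prop)) ε
    fun _ _ => abs_spread_integrand_le hε _ _]
  refine setIntegral_congr_fun measurableSet_Icc fun τ hτ => ?_
  rw [integral_const_mul]
  split_ifs with h
  · rw [integral_indicator_Icc (c := u - (1 - τ)) (d := u + (1 - τ)) rfl ?_, max_eq_left (by linarith [hτ.2])]
    · ring
    · intro v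
      simp only [h, true_and, Set.mem_Icc, abs_le (a := v - u)]
      rw [abs_le] at h
      constructor
      · rintro ⟨_, _, _⟩; constructor <;> linarith
      · rintro ⟨_, _⟩; refine ⟨⟨?_, ?_⟩, ?_, ?_⟩ <;> linarith
  · simp [h]

/-- Half the length of `[-τ, τ] ∩ [v - (1 - τ), v + (1 - τ)]`. The two subtracted terms are the
parts of `[-τ, τ]` cut off on either side; they are exactly what the two jumps deliver to `v`. -/
lemma integral_spread_left {ε b v : ℝ} (hε : 0 < ε) (hb : b < 1) (hv : |v| ≤ 1) :
    ∫ u in Set.Icc (-1 : ℝ) 1, spread ε b u v =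
      ∫ τ in Set.Icc 0 b, layer ε τ *
        (τ - max (2 * τ - 1 + v) 0 / 2 - max (2 * τ - 1 + -v) 0 / 2) := by
  unfold spread
  rw [integral_swap_of_bound (f := fun u τ =>
      layer ε τ / 2 * (if |u| ≤ τ ∧ |v - u| ≤ 1 - τ then (1 : ℝ) else 0))
    ((measurable_spread_integrand ε).comp (f := fun x : ℝ × ℝ => ((x.1, v), x.2)) (by fun_prop)) ε
    fun _ _ => abs_spread_integrand_le hε _ _]
  refine setIntegral_congr_fun measurableSet_Icc fun τ hτ => ?_
  have hτb := hτ.2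
  have hτ0 := hτ.1
  rw [abs_le] at hv
  rw [integral_const_mul, integral_indicator_Icc (c := max (-τ) (v - (1 - τ)))
    (d := min τ (v + (1 - τ))) rfl ?_, max_eq_left]
  · rw [div_mul_eq_mul_div, mul_div_assoc, max_def, min_def, max_def, max_def]
    congr 1
    split_ifs <;> linarith
  · rw [sub_nonneg, max_le_iff, le_min_iff, le_min_iff]
    refine ⟨⟨?_, ?_⟩, ?_, ?_⟩ <;> linarith
  · intro u
    simp only [Set.mem_Icc, abs_le, max_le_iff, le_min_iff]
    constructor
    · rintro ⟨_, ⟨_, _⟩, _, _⟩; refine ⟨⟨?_, ?_⟩, ?_, ?_⟩ <;> linarith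
    · rintro ⟨⟨_, _⟩, _, _⟩; refine ⟨⟨?_, ?_⟩, ⟨?_, ?_⟩, ?_, ?_⟩ <;> linarith

lemma abs_jump_le {ε b u v : ℝ} (hε : 0 < ε) (hu : |u| ≤ 1) (hv : |v| ≤ 1) :
    ‖jump ε b u v‖ ≤ 4 * ε := by
  rw [Real.norm_of_nonneg (jump_nonneg ε b u v (abs_le.1 hv).2)]
  unfold jump
  rw [abs_le] at hu hv
  split_ifs with h
  · have h1 := (abs_le.1 (abs_layer_le ε (1 - v + u) hε)).2
    have h2 : max (1 - v + 2 * u) 0 ≤ 4 := max_le (by linarith) (by norm_num)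
    have h3 : 0 ≤ max (1 - v + 2 * u) 0 := le_max_right _ _
    nlinarith
  · linarith

lemma abs_spread_le {ε b u v : ℝ} (hε : 0 < ε) (hb : b < 1) : ‖spread ε b u v‖ ≤ ε := by
  rw [Real.norm_of_nonneg (spread_nonneg _ _ _ _)]
  refine (spread_le hε).trans ?_
  have h1 : tent ε (v - u) ≤ 2 * ε := max_le (by linarith [abs_nonneg (v - u)]) (by linarith)
  have h2 : max (min b (1 - |v - u|) - |u|) 0 ≤ 1 :=
    max_le (by linarith [min_le_left b (1 - |v - u|), abs_nonneg u]) zero_le_one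
  have h3 : 0 ≤ max (min b (1 - |v - u|) - |u|) 0 := le_max_right _ _
  have := tent_nonneg ε (v - u)
  nlinarith

lemma integrableOn_of_bound {f : ℝ → ℝ} (hf : Measurable f) {x y C : ℝ}
    (hC : ∀ t ∈ Set.Icc x y, ‖f t‖ ≤ C) : IntegrableOn f (Set.Icc x y) :=
  Integrable.of_bound hf.aestronglyMeasurable C
    ((ae_restrict_iff' measurableSet_Icc).2 (.of_forall hC))

/-- Layer by layer, the mass leaving `u` is `(τ + u) / 2 + (τ - u) / 2 + (1 - τ) = 1`. -/
lemma integral_transport_right {ε b u : ℝ} (hε : 0 < ε) (hb : b < 1) (hu : |u| ≤ b) :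
    ∫ v in Set.Icc (-1 : ℝ) 1, transport ε b u v = overlap ε u - overlap ε b := by
  have hu1 : |u| ≤ 1 := hu.trans hb.le
  have hj := measurable_jump ε b
  have hs := measurable_spread ε b
  have i1 : IntegrableOn (fun v => jump ε b u v) (Set.Icc (-1) 1) :=
    integrableOn_of_bound (hj.comp measurable_prodMk_left)
      fun v hv => abs_jump_le hε hu1 (abs_le.2 hv)
  have i2 : IntegrableOn (fun v => jump ε b (-u) (-v)) (Set.Icc (-1) 1) :=
    integrableOn_of_bound (hj.comp (measurable_prodMk_left.comp measurable_neg))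
      fun v hv => abs_jump_le hε (by simpa) (by simpa using abs_le.2 hv)
  have i3 : IntegrableOn (fun v => spread ε b u v) (Set.Icc (-1) 1) :=
    integrableOn_of_bound (hs.comp measurable_prodMk_left) fun v _ => abs_spread_le hε hb
  have hm : MeasurableSet {τ : ℝ | |u| ≤ τ} := measurableSet_Ici
  have hi : ∀ f : ℝ → ℝ, Continuous f →
      IntegrableOn (fun τ => layer ε τ * (if |u| ≤ τ then f τ else 0)) (Set.Icc 0 b) := by
    intro f hf
    have : IntegrableOn (fun τ => layer ε τ * f τ) (Set.Icc 0 b) :=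
      ((continuous_layer ε).mul hf).integrableOn_Icc
    refine (this.indicator hm).congr (.of_forall fun τ => ?_)
    simp [Set.indicator_apply]
  unfold transport
  rw [integral_add_add i1 i2 i3,
    integral_neg_Icc (fun v => jump ε b (-u) v), integral_jump_right ε hb hu,
    integral_jump_right ε hb (by rwa [abs_neg]), integral_spread_right hε hb, abs_neg,
    ← integral_add_add (hi _ (by fun_prop)) (hi _ (by fun_prop)) (hi _ (by fun_prop)),
    ← overlap_abs ε u, overlap_sub_overlap, intervalIntegral.integral_of_le hu,
    ← integral_Icc_eq_integral_Ioc, ← integral_indicator measurableSet_Icc,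
    ← integral_indicator measurableSet_Icc]
  congr 1 with τ
  have := abs_nonneg u
  simp only [Set.indicator_apply, Set.mem_Icc]
  by_cases h : |u| ≤ τ
  · simp only [h, if_true, true_and, this.trans h]
    split_ifs <;> ring
  · simp [h]

/-- The jumps fill the deficits of the spread, so each layer arrives with density `τ` at every `v`.
-/
lemma integral_transport_left {ε b v : ℝ} (hε : 0 < ε) (hb : b < 1) (hv : |v| ≤ 1) :
    ∫ u in Set.Icc (-1 : ℝ) 1, transport ε b u v = ∫ τ in Set.Icc 0 b, layer ε τ * τ := by
  have hj := measurable_jump ε b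
  have hs := measurable_spread ε b
  have i1 : IntegrableOn (fun u => jump ε b u v) (Set.Icc (-1) 1) :=
    integrableOn_of_bound (hj.comp measurable_prodMk_right)
      fun u hu => abs_jump_le hε (abs_le.2 hu) hv
  have i2 : IntegrableOn (fun u => jump ε b (-u) (-v)) (Set.Icc (-1) 1) :=
    integrableOn_of_bound (hj.comp (measurable_prodMk_right.comp measurable_neg))
      fun u hu => abs_jump_le hε (by simpa using abs_le.2 hu) (by simpa)
  have i3 : IntegrableOn (fun u => spread ε b u v) (Set.Icc (-1) 1) :=
    integrableOn_of_bound (hs.comp measurable_prodMk_right) fun v _ => abs_spread_le hε hb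
  have hi : ∀ f : ℝ → ℝ, Continuous f →
      IntegrableOn (fun τ => layer ε τ * f τ) (Set.Icc 0 b) := fun f hf =>
    ((continuous_layer ε).mul hf).integrableOn_Icc
  unfold transport
  rw [integral_add_add i1 i2 i3,
    integral_neg_Icc (fun u => jump ε b u (-v)), integral_jump_left ε hb hv,
    integral_jump_left ε hb (by rwa [abs_neg]), integral_spread_left hε hb hv,
    ← integral_add_add (hi _ (by fun_prop)) (hi _ (by fun_prop)) (hi _ (by fun_prop))]
  congr 1 with τ
  ring

/-! ### The selection rule -/

/-- The indicator of the event that a message at distance `t` from the signal is consistent. -/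
noncomputable def window (ε t : ℝ) : ℝ := if |t| ≤ ε then 1 else 0

/-- The probability that speaker 2 is selected if both messages are consistent with the signal. -/
noncomputable def share (ε b u v : ℝ) : ℝ := max 0 (min 1 (transport ε b u v / tent ε (u - v)))

/-- The probability that speaker 1 is selected after messages `u`, `v` and signal `s`. -/
noncomputable def accept (ε b u v s : ℝ) : ℝ :=
  window ε (s - u) * (1 - share ε b u v * window ε (s - v))

lemma window_nonneg (ε t : ℝ) : 0 ≤ window ε t := by unfold window; split_ifs <;> norm_num

lemma window_le_one (ε t : ℝ) : window ε t ≤ 1 := by unfold window; split_ifs <;> norm_num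

lemma window_mul_self (ε t : ℝ) : window ε t * window ε t = window ε t := by
  unfold window; split_ifs <;> norm_num

lemma measurable_window (ε : ℝ) : Measurable (window ε) :=
  Measurable.ite (measurableSet_le (by fun_prop) (by fun_prop)) measurable_const measurable_const

lemma share_nonneg (ε b u v : ℝ) : 0 ≤ share ε b u v := le_max_left _ _

lemma share_le_one (ε b u v : ℝ) : share ε b u v ≤ 1 := max_le zero_le_one (min_le_left _ _)

/-- The clamping in `share` is inactive on messages, and where `tent` vanishes so does `transport`,
so the division by zero is harmless. -/
lemma share_mul_tent {ε b u v : ℝ} (hε : 0 < ε) (hb : b < 1) (hu : |u| ≤ 1) (hv : |v| ≤ 1) :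
    share ε b u v * tent ε (u - v) = transport ε b u v := by
  have h0 := transport_nonneg ε b (u := u) hv
  have h1 := transport_le hε hb hu hv
  have h2 := tent_nonneg ε (u - v)
  rcases h2.eq_or_lt with h | h
  · rw [← h] at h1 ⊢
    rw [mul_zero]
    linarith
  · unfold share
    rw [min_eq_right ((div_le_one h).2 h1), max_eq_right (by positivity), div_mul_cancel₀ _ h.ne']

lemma share_eq_zero {ε b u v : ℝ} (h : transport ε b u v = 0) : share ε b u v = 0 := by
  simp [share, h]

lemma measurable_share (ε b : ℝ) : Measurable fun x : ℝ × ℝ => share ε b x.1 x.2 := by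
  have h1 := measurable_transport ε b
  have h2 := (continuous_tent ε).measurable
  unfold share
  fun_prop

lemma measurable_accept (ε b : ℝ) :
    Measurable fun x : (ℝ × ℝ) × ℝ => accept ε b x.1.1 x.1.2 x.2 := by
  have h1 : Measurable fun x : (ℝ × ℝ) × ℝ => share ε b x.1.1 x.1.2 :=
    (measurable_share ε b).comp measurable_fst
  have h2 := measurable_window ε
  exact (h2.comp (by fun_prop)).mul (measurable_const.sub (h1.mul (h2.comp (by fun_prop))))

lemma accept_nonneg (ε b u v s : ℝ) : 0 ≤ accept ε b u v s := by
  have h1 := window_nonneg ε (s - u)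
  have h2 := mul_le_one₀ (share_le_one ε b u v) (window_nonneg ε (s - v)) (window_le_one _ _)
  exact mul_nonneg h1 (by linarith)

lemma accept_le_window (ε b u v s : ℝ) : accept ε b u v s ≤ window ε (s - u) := by
  have h2 := mul_nonneg (share_nonneg ε b u v) (window_nonneg ε (s - v))
  exact mul_le_of_le_one_right (window_nonneg _ _) (by linarith)

lemma accept_le_one (ε b u v s : ℝ) : accept ε b u v s ≤ 1 :=
  (accept_le_window _ _ _ _ _).trans (window_le_one _ _)

lemma norm_window_mul_le {ε t x : ℝ} (h0 : 0 ≤ x) (h1 : x ≤ 1) : ‖window ε t * x‖ ≤ 1 := by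
  rw [Real.norm_of_nonneg (mul_nonneg (window_nonneg _ _) h0)]
  exact mul_le_one₀ (window_le_one _ _) h0 h1

lemma integral_window_mul_window {ε u v : ℝ} (hε1 : ε < 1) (hu : |u| ≤ 1) :
    ∫ s in Set.Icc (-3 : ℝ) 3, window ε (s - v) * window ε (s - u) = tent ε (u - v) := by
  have h : ∀ s, window ε (s - v) * window ε (s - u) =
      if |s - v| ≤ ε ∧ |s - u| ≤ ε then 1 else 0 := fun s => by
    unfold window
    by_cases h1 : |s - v| ≤ ε <;> by_cases h2 : |s - u| ≤ ε <;> simp [h1, h2]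
  simp_rw [h]
  rw [abs_le] at hu
  rw [integral_indicator_Icc (c := max (u - ε) (v - ε)) (d := min (u + ε) (v + ε)) rfl]
  · rw [max_sub_sub_right, min_add_add_right, tent, ← max_sub_min_eq_abs, max_comm v, min_comm v]
    congr 1
    ring
  · intro s
    simp only [Set.mem_Icc, abs_le, max_le_iff, le_min_iff]
    constructor
    · rintro ⟨⟨_, _⟩, ⟨_, _⟩, _, _⟩; refine ⟨⟨?_, ?_⟩, ?_, ?_⟩ <;> linarith
    · rintro ⟨⟨_, _⟩, _, _⟩; refine ⟨⟨?_, ?_⟩, ⟨?_, ?_⟩, ?_, ?_⟩ <;> linarith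

lemma integrableOn_window_mul_window (ε u v : ℝ) :
    IntegrableOn (fun s => window ε (s - v) * window ε (s - u)) (Set.Icc (-3 : ℝ) 3) := by
  have := measurable_window ε
  exact integrableOn_of_bound (by fun_prop)
    fun s _ => norm_window_mul_le (window_nonneg _ _) (window_le_one _ _)

lemma integral_share_mul_window {ε b u v : ℝ} (hε : 0 < ε) (hε1 : ε < 1) (hb : b < 1)
    (hu : |u| ≤ 1) (hv : |v| ≤ 1) :
    ∫ s in Set.Icc (-3 : ℝ) 3, share ε b u v * (window ε (s - v) * window ε (s - u)) =
      transport ε b u v := by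
  rw [integral_const_mul, integral_window_mul_window hε1 hu, share_mul_tent hε hb hu hv]

lemma window_mul_accept (ε b u v s : ℝ) :
    window ε (s - v) * accept ε b u v s = window ε (s - v) * window ε (s - u) -
      share ε b u v * (window ε (s - v) * window ε (s - u)) := by
  unfold accept
  linear_combination - share ε b u v * window ε (s - u) * window_mul_self ε (s - v)

lemma integral_window_mul_accept {ε b u v : ℝ} (hε : 0 < ε) (hε1 : ε < 1) (hb : b < 1)
    (hu : |u| ≤ 1) (hv : |v| ≤ 1) :
    ∫ s in Set.Icc (-3 : ℝ) 3, window ε (s - v) * accept ε b u v s =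
      tent ε (u - v) - transport ε b u v := by
  simp_rw [window_mul_accept]
  rw [integral_sub (integrableOn_window_mul_window _ _ _)
    ((integrableOn_window_mul_window _ _ _).const_mul _),
    integral_window_mul_window hε1 hu, integral_share_mul_window hε hε1 hb hu hv]

lemma integrableOn_transport_right {ε b u : ℝ} (hε : 0 < ε) (hb : b < 1) (hu : |u| ≤ 1) :
    IntegrableOn (fun v => transport ε b u v) (Set.Icc (-1) 1) := by
  refine integrableOn_of_bound ((measurable_transport ε b).comp measurable_prodMk_left)
    (C := 2 * ε) fun v hv => ?_
  change ‖transport ε b u v‖ ≤ _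
  rw [Real.norm_of_nonneg (transport_nonneg _ _ (abs_le.2 hv))]
  exact (transport_le hε hb hu (abs_le.2 hv)).trans
    (max_le (by linarith [abs_nonneg (u - v)]) (by linarith))

/-! ### Incentives of the quacks and the experts -/

/-- The unnormalized probability that speaker 1 is selected if he is the quack and sends `u`. -/
noncomputable def quackGain (ε b u : ℝ) : ℝ :=
  ∫ v in Set.Icc (-1 : ℝ) 1, ∫ s in Set.Icc (-3 : ℝ) 3, window ε (s - v) * accept ε b u v s

lemma quackGain_eq {ε b u : ℝ} (hε : 0 < ε) (hε1 : ε < 1) (hb : b < 1) (hu : |u| ≤ 1) :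
    quackGain ε b u = overlap ε u - ∫ v in Set.Icc (-1 : ℝ) 1, transport ε b u v := by
  unfold quackGain overlap
  rw [← integral_sub _ (integrableOn_transport_right hε hb hu)]
  · exact setIntegral_congr_fun measurableSet_Icc fun v hv =>
      integral_window_mul_accept hε hε1 hb hu (abs_le.2 hv)
  · exact ((continuous_tent ε).comp (continuous_const.sub continuous_id)).integrableOn_Icc

lemma quackGain_of_abs_le {ε b u : ℝ} (hε : 0 < ε) (hε1 : ε < 1) (hb : b < 1) (hu : |u| ≤ b) :
    quackGain ε b u = overlap ε b := by
  rw [quackGain_eq hε hε1 hb (hu.trans hb.le), integral_transport_right hε hb hu]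
  ring

lemma quackGain_le {ε b u : ℝ} (hε : 0 < ε) (hε1 : ε < 1) (hb0 : 0 ≤ b) (hb : b < 1)
    (hu : |u| ≤ 1) : quackGain ε b u ≤ overlap ε b := by
  rcases le_or_gt |u| b with h | h
  · exact (quackGain_of_abs_le hε hε1 hb h).le
  -- Outside `[-b, b]` nothing is transported, but the overlap with the state space is already no
  -- larger than at `b`.
  · have h0 : ∀ v ∈ Set.Icc (-1 : ℝ) 1, transport ε b u v = 0 := fun v hv =>
      transport_eq_zero_of_lt ε (abs_le.2 hv) h
    rw [quackGain_eq hε hε1 hb hu, setIntegral_eq_zero_of_forall_eq_zero h0, sub_zero]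
    exact overlap_le hb0 h.le

lemma integral_transport_left_restrict {ε b v : ℝ} (hε : 0 < ε) (hb : b < 1) (hv : |v| ≤ 1) :
    ∫ u in Set.Icc (-b) b, transport ε b u v = ∫ τ in Set.Icc 0 b, layer ε τ * τ := by
  rw [← integral_transport_left hε hb hv]
  refine (setIntegral_eq_of_subset_of_forall_sdiff_eq_zero measurableSet_Icc
    (Set.Icc_subset_Icc (by linarith) hb.le) fun u hu => ?_).symm
  exact transport_eq_zero_of_lt ε hv (not_le.1 fun h => hu.2 (abs_le.1 h))

lemma integrable_integral_of_bound {μ ν : Measure ℝ} [IsFiniteMeasure μ] [IsFiniteMeasure ν]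
    {f : ℝ → ℝ → ℝ} (hf : Measurable (Function.uncurry f)) (C : ℝ) (hC : ∀ x y, ‖f x y‖ ≤ C) :
    Integrable (fun x => ∫ y, f x y ∂ν) μ :=
  (Integrable.of_bound (f := Function.uncurry f) (μ := μ.prod ν) hf.aestronglyMeasurable C
    (.of_forall fun _ => hC _ _)).integral_prod_left

lemma integral_integral_mono_of_bound {μ ν : Measure ℝ} [IsFiniteMeasure μ] [IsFiniteMeasure ν]
    {f g : ℝ → ℝ → ℝ} (hf : Measurable (Function.uncurry f)) (hg : Measurable (Function.uncurry g))
    (C : ℝ) (hfC : ∀ x y, ‖f x y‖ ≤ C) (hgC : ∀ x y, ‖g x y‖ ≤ C) (h : ∀ x y, f x y ≤ g x y) :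
    ∫ x, ∫ y, f x y ∂ν ∂μ ≤ ∫ x, ∫ y, g x y ∂ν ∂μ :=
  integral_mono (integrable_integral_of_bound hf C hfC) (integrable_integral_of_bound hg C hgC)
    fun x => integral_mono (Integrable.of_bound (hf.of_uncurry_left).aestronglyMeasurable C
      (.of_forall (hfC x))) (Integrable.of_bound (hg.of_uncurry_left).aestronglyMeasurable C
      (.of_forall (hgC x))) (h x)

lemma integral_integral_add_of_bound {μ ν : Measure ℝ} [IsFiniteMeasure μ] [IsFiniteMeasure ν]
    {f g : ℝ → ℝ → ℝ} (hf : Measurable (Function.uncurry f)) (hg : Measurable (Function.uncurry g))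
    (C : ℝ) (hfC : ∀ x y, ‖f x y‖ ≤ C) (hgC : ∀ x y, ‖g x y‖ ≤ C) :
    ∫ x, ∫ y, f x y + g x y ∂ν ∂μ = ∫ x, ∫ y, f x y ∂ν ∂μ + ∫ x, ∫ y, g x y ∂ν ∂μ := by
  rw [← integral_add (integrable_integral_of_bound hf C hfC)
    (integrable_integral_of_bound hg C hgC)]
  congr 1 with x
  exact integral_add (Integrable.of_bound (hf.of_uncurry_left).aestronglyMeasurable C
      (.of_forall (hfC x))) (Integrable.of_bound (hg.of_uncurry_left).aestronglyMeasurable C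
      (.of_forall (hgC x)))

/-- The unnormalized probability that speaker 1 is selected if he is the expert, the state is `w`
and he sends `u`. -/
noncomputable def expertGain (ε b w u : ℝ) : ℝ :=
  ∫ s in Set.Icc (-3 : ℝ) 3, ∫ v in Set.Icc (-1 : ℝ) 1, window ε (s - w) * accept ε b u v s

/-- The unnormalized probability that speaker 2 is selected if he is the expert, the state is `w`
and he sends `v`. -/
noncomputable def expertGain' (ε b w v : ℝ) : ℝ :=
  ∫ s in Set.Icc (-3 : ℝ) 3, ∫ u in Set.Icc (-b) b, window ε (s - w) * (1 - accept ε b u v s)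

lemma norm_sub_window_le {ε t r : ℝ} : ‖window ε t * (1 - window ε r)‖ ≤ 1 :=
  norm_window_mul_le (by linarith [window_le_one ε r]) (by linarith [window_nonneg ε r])

/-- Split signals by whether the quack's `v` is consistent. If it is not, winning is bounded by
`window ε (s - w)`, whatever `u` is. If it is, dropping the factor `window ε (s - w)` leaves the
integrand of `quackGain`, maximal for `|u| ≤ b`. Both bounds are attained at `u = w` when `|w| ≤ b`.
-/
lemma expertGain_le {ε b w u : ℝ} (hε : 0 < ε) (hε1 : ε < 1) (hb0 : 0 ≤ b) (hb : b < 1)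
    (hu : |u| ≤ 1) : expertGain ε b w u ≤ expertGain ε b w w := by
  have ha := measurable_accept ε b
  have hwm := measurable_window ε
  have ha' : ∀ u, Measurable fun x : ℝ × ℝ => accept ε b u x.2 x.1 := fun u =>
    ha.comp (f := fun x : ℝ × ℝ => ((u, x.2), x.1)) (by fun_prop)
  have m1 : ∀ u, Measurable (Function.uncurry fun s v => window ε (s - w) * accept ε b u v s) :=
    fun u => Measurable.mul (by fun_prop) (ha' u)
  have m2 : Measurable (Function.uncurry fun s v => window ε (s - w) * (1 - window ε (s - v))) := by
    unfold Function.uncurry; fun_prop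
  have m3 : ∀ u, Measurable (Function.uncurry fun s v => window ε (s - v) * accept ε b u v s) :=
    fun u => Measurable.mul (by fun_prop) (ha' u)
  have b1 : ∀ t u v s, ‖window ε t * accept ε b u v s‖ ≤ 1 := fun t u v s =>
    norm_window_mul_le (accept_nonneg _ _ _ _ _) (accept_le_one _ _ _ _ _)
  rcases le_or_gt |w| b with h | h
  · have e : ∀ u, ∫ s in Set.Icc (-3 : ℝ) 3, ∫ v in Set.Icc (-1 : ℝ) 1,
        (window ε (s - w) * (1 - window ε (s - v)) + window ε (s - v) * accept ε b u v s) =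
        (∫ s in Set.Icc (-3 : ℝ) 3, ∫ v in Set.Icc (-1 : ℝ) 1,
          window ε (s - w) * (1 - window ε (s - v))) + quackGain ε b u := fun u => by
      rw [integral_integral_add_of_bound m2 (m3 u) 1 (fun _ _ => norm_sub_window_le)
        (fun _ _ => b1 _ _ _ _)]
      congr 1
      exact integral_swap_of_bound (m3 u) 1 fun _ _ => b1 _ _ _ _
    calc expertGain ε b w u
        ≤ ∫ s in Set.Icc (-3 : ℝ) 3, ∫ v in Set.Icc (-1 : ℝ) 1,
          (window ε (s - w) * (1 - window ε (s - v)) + window ε (s - v) * accept ε b u v s) := by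
          refine integral_integral_mono_of_bound (m1 u) (m2.add (m3 u)) 2
            (fun _ _ => (b1 _ _ _ _).trans one_le_two)
            (fun _ _ => (norm_add_le _ _).trans ((add_le_add norm_sub_window_le
              (b1 _ _ _ _)).trans_eq one_add_one_eq_two)) fun s v => ?_
          · have h0 := accept_nonneg ε b u v s
            have h1 := accept_le_one ε b u v s
            unfold window
            split_ifs <;> linarith
      _ ≤ ∫ s in Set.Icc (-3 : ℝ) 3, ∫ v in Set.Icc (-1 : ℝ) 1,
          (window ε (s - w) * (1 - window ε (s - v)) + window ε (s - v) * accept ε b w v s) := by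
          rw [e, e, quackGain_of_abs_le hε hε1 hb h]
          linarith [quackGain_le hε hε1 hb0 hb hu]
      _ = expertGain ε b w w := by
          unfold expertGain accept window
          congr 1 with s
          congr 1 with v
          split_ifs <;> ring
  -- For `|w| > b` the share at `w` is zero, so truth wins with certainty.
  · refine setIntegral_mono_on (integrable_integral_of_bound (m1 u) 1 fun _ _ => b1 _ _ _ _)
      (integrable_integral_of_bound (m1 w) 1 fun _ _ => b1 _ _ _ _) measurableSet_Icc fun s _ => ?_
    refine setIntegral_mono_on
      (integrableOn_of_bound (m1 u).of_uncurry_left fun _ _ => b1 _ _ _ _)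
      (integrableOn_of_bound (m1 w).of_uncurry_left fun _ _ => b1 _ _ _ _)
      measurableSet_Icc fun v hv => ?_
    have : accept ε b w v s = window ε (s - w) := by
      rw [accept, share_eq_zero (transport_eq_zero_of_lt ε (abs_le.2 hv) h)]
      ring
    rw [this, window_mul_self]
    exact mul_le_of_le_one_right (window_nonneg _ _) (accept_le_one _ _ _ _ _)

lemma one_sub_accept (ε b u v s : ℝ) :
    1 - accept ε b u v s =
      1 - window ε (s - u) + share ε b u v * (window ε (s - v) * window ε (s - u)) := by
  unfold accept; ring

lemma norm_share_mul_le {ε b u v t r : ℝ} : ‖share ε b u v * (window ε t * window ε r)‖ ≤ 1 := by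
  have := window_nonneg ε t
  have := window_nonneg ε r
  have := share_nonneg ε b u v
  rw [Real.norm_of_nonneg (by positivity)]
  exact mul_le_one₀ (share_le_one _ _ _ _) (by positivity)
    (mul_le_one₀ (window_le_one _ _) (by positivity) (window_le_one _ _))

-- Speaker 2 wins either because `u` is inconsistent, which `v` cannot affect, or through `share`.
-- Dropping `window ε (s - w)` from the second term leaves the mass transported to `v`, the same for
-- all `v`; at `v = w` nothing is lost.
set_option maxHeartbeats 1000000 in
lemma expertGain'_le {ε b w v : ℝ} (hε : 0 < ε) (hε1 : ε < 1) (hb : b < 1)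
    (hw : |w| ≤ 1) (hv : |v| ≤ 1) : expertGain' ε b w v ≤ expertGain' ε b w w := by
  have hwm := measurable_window ε
  have hs : ∀ v, Measurable fun u => share ε b u v := fun v =>
    (measurable_share ε b).comp measurable_prodMk_right
  have ha' : ∀ v, Measurable fun x : ℝ × ℝ => accept ε b x.2 v x.1 := fun v =>
    (measurable_accept ε b).comp (f := fun x : ℝ × ℝ => ((x.2, v), x.1)) (by fun_prop)
  have m1 : ∀ v, Measurable
      (Function.uncurry fun s u => window ε (s - w) * (1 - accept ε b u v s)) :=
    fun v => Measurable.mul (by fun_prop) (measurable_const.sub (ha' v))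
  have m2 : Measurable (Function.uncurry fun s u => window ε (s - w) * (1 - window ε (s - u))) := by
    unfold Function.uncurry; fun_prop
  have m3 : ∀ v, Measurable (Function.uncurry fun s u =>
      share ε b u v * (window ε (s - v) * window ε (s - u))) :=
    fun v => ((hs v).comp measurable_snd).mul (by fun_prop)
  have b1 : ∀ t u v s, ‖window ε t * (1 - accept ε b u v s)‖ ≤ 1 := fun t u v s =>
    norm_window_mul_le (by linarith [accept_le_one ε b u v s])
      (by linarith [accept_nonneg ε b u v s])
  have e : ∀ v, |v| ≤ 1 → ∫ s in Set.Icc (-3 : ℝ) 3, ∫ u in Set.Icc (-b) b,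
      (window ε (s - w) * (1 - window ε (s - u)) +
        share ε b u v * (window ε (s - v) * window ε (s - u))) =
      (∫ s in Set.Icc (-3 : ℝ) 3, ∫ u in Set.Icc (-b) b,
        window ε (s - w) * (1 - window ε (s - u))) +
        ∫ τ in Set.Icc 0 b, layer ε τ * τ := fun v hv => by
    rw [integral_integral_add_of_bound m2 (m3 v) 1 (fun _ _ => norm_sub_window_le)
      (fun _ _ => norm_share_mul_le), integral_swap_of_bound (m3 v) 1 fun _ _ => norm_share_mul_le,
      ← integral_transport_left_restrict hε hb hv]
    congr 1
    refine setIntegral_congr_fun measurableSet_Icc fun u hu => ?_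
    exact integral_share_mul_window hε hε1 hb ((abs_le.2 hu).trans hb.le) hv
  calc expertGain' ε b w v
      ≤ ∫ s in Set.Icc (-3 : ℝ) 3, ∫ u in Set.Icc (-b) b,
        (window ε (s - w) * (1 - window ε (s - u)) +
          share ε b u v * (window ε (s - v) * window ε (s - u))) := by
        refine integral_integral_mono_of_bound (m1 v) (m2.add (m3 v)) 2
          (fun _ _ => (b1 _ _ _ _).trans one_le_two)
          (fun _ _ => (norm_add_le _ _).trans ((add_le_add norm_sub_window_le
            norm_share_mul_le).trans_eq one_add_one_eq_two)) fun s u => ?_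
        · rw [one_sub_accept]
          have h0 := share_nonneg ε b u v
          unfold window
          split_ifs <;> linarith
    _ = ∫ s in Set.Icc (-3 : ℝ) 3, ∫ u in Set.Icc (-b) b,
        (window ε (s - w) * (1 - window ε (s - u)) +
          share ε b u w * (window ε (s - w) * window ε (s - u))) := by
        rw [e v hv, e w hw]
    _ = expertGain' ε b w w := by
        unfold expertGain'
        simp_rw [one_sub_accept]
        unfold window
        congr 1 with s
        congr 1 with u
        split_ifs <;> ring

lemma integral_window_mul_one_sub_accept {ε b v : ℝ} (hε : 0 < ε) (hε1 : ε < 1) (hb : b < 1)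
    (hv : |v| ≤ 1) :
    ∫ u in Set.Icc (-1 : ℝ) 1, ∫ s in Set.Icc (-3 : ℝ) 3,
      window ε (s - u) * (1 - accept ε b u v s) = ∫ τ in Set.Icc 0 b, layer ε τ * τ := by
  rw [← integral_transport_left hε hb hv]
  refine setIntegral_congr_fun measurableSet_Icc fun u hu => ?_
  rw [← integral_share_mul_window hε hε1 hb (abs_le.2 hu) hv]
  congr 1 with s
  unfold accept
  linear_combination (share ε b u v * window ε (s - v) - 1) * window_mul_self ε (s - u)

/-! ### Uniform laws as Lebesgue integrals -/

/-- Lebesgue measure on the space of messages. -/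
noncomputable def msgVolume : Measure Msg := (volume : Measure ℝ).comap ((↑) : Msg → ℝ)

lemma measurableEmbedding_msg : MeasurableEmbedding ((↑) : Msg → ℝ) :=
  MeasurableEmbedding.subtype_coe measurableSet_Icc

lemma map_msgVolume : msgVolume.map ((↑) : Msg → ℝ) = volume.restrict (Set.Icc (-1) 1) := by
  rw [msgVolume, measurableEmbedding_msg.map_comap, Subtype.range_coe]

instance : IsFiniteMeasure msgVolume := by
  refine ⟨?_⟩
  have := measurableEmbedding_msg.map_apply msgVolume Set.univ
  rw [map_msgVolume, Set.preimage_univ] at this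
  rw [← this]
  exact measure_lt_top _ _

lemma measurableSet_abs_le_msg (c : ℝ) : MeasurableSet {m : Msg | |(m : ℝ)| ≤ c} :=
  measurableSet_le (by fun_prop) (by fun_prop)

lemma map_msgVolume_restrict {c : ℝ} (hc : c ≤ 1) :
    (msgVolume.restrict {m : Msg | |(m : ℝ)| ≤ c}).map ((↑) : Msg → ℝ) =
      volume.restrict (Set.Icc (-c) c) := by
  have : {m : Msg | |(m : ℝ)| ≤ c} = ((↑) : Msg → ℝ) ⁻¹' Set.Icc (-c) c := by
    ext m; simp [abs_le]
  rw [this, ← measurableEmbedding_msg.restrict_map, map_msgVolume,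
    Measure.restrict_restrict measurableSet_Icc,
    Set.inter_eq_self_of_subset_left (Set.Icc_subset_Icc (by linarith) hc)]

lemma msgVolume_abs_le {c : ℝ} (hc : c ≤ 1) :
    msgVolume {m : Msg | |(m : ℝ)| ≤ c} = ENNReal.ofReal (2 * c) := by
  have := congrArg (fun μ => μ Set.univ) (map_msgVolume_restrict hc)
  rw [measurableEmbedding_msg.map_apply] at this
  simp only [Set.preimage_univ, Measure.restrict_apply_univ, Real.volume_Icc] at this
  rw [this]
  ring_nf

lemma uniformMsg_eq {c : ℝ} (hc0 : 0 < c) (hc : c ≤ 1) :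
    uniformMsg c = ENNReal.ofReal (2 * c)⁻¹ • msgVolume.restrict {m : Msg | |(m : ℝ)| ≤ c} := by
  rw [uniformMsg, ProbabilityTheory.cond, ENNReal.ofReal_inv_of_pos (by positivity),
    ← msgVolume_abs_le hc, msgVolume]

lemma isProbabilityMeasure_uniformMsg {c : ℝ} (hc0 : 0 < c) (hc : c ≤ 1) :
    IsProbabilityMeasure (uniformMsg c) := by
  refine ⟨?_⟩
  rw [uniformMsg_eq hc0 hc, Measure.smul_apply, Measure.restrict_apply_univ, msgVolume_abs_le hc,
    smul_eq_mul, ← ENNReal.ofReal_mul (by positivity), inv_mul_cancel₀ (by positivity),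
    ENNReal.ofReal_one]

lemma integral_uniformMsg {c : ℝ} (hc0 : 0 < c) (hc : c ≤ 1) (f : ℝ → ℝ) :
    ∫ m : Msg, f m ∂uniformMsg c = (2 * c)⁻¹ * ∫ x in Set.Icc (-c) c, f x := by
  rw [uniformMsg_eq hc0 hc, integral_smul_measure, ← map_msgVolume_restrict hc,
    measurableEmbedding_msg.integral_map, ENNReal.toReal_ofReal (by positivity), smul_eq_mul]

lemma noiseLaw_eq {ε : ℝ} (hε : 0 < ε) :
    noiseLaw ε = ENNReal.ofReal (2 * ε)⁻¹ • volume.restrict (Set.Icc (-ε) ε) := by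
  rw [noiseLaw, ProbabilityTheory.cond, ENNReal.ofReal_inv_of_pos (by positivity), Real.volume_Icc]
  ring_nf

lemma isProbabilityMeasure_noiseLaw {ε : ℝ} (hε : 0 < ε) : IsProbabilityMeasure (noiseLaw ε) :=
  ⟨by
    rw [noiseLaw_eq hε, Measure.smul_apply, Measure.restrict_apply_univ, Real.volume_Icc,
      smul_eq_mul, ← ENNReal.ofReal_mul (by positivity), sub_neg_eq_add, ← two_mul,
      inv_mul_cancel₀ (by positivity), ENNReal.ofReal_one]⟩

/-- Since `|w| ≤ 1` and `ε < 1`, all signals lie in `[-3, 3]`, a fixed range of finite measure on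
which Fubini applies to bounded functions. -/
lemma integral_noiseLaw {ε w : ℝ} (hε : 0 < ε) (hε1 : ε < 1) (hw : |w| ≤ 1) (f : ℝ → ℝ) :
    ∫ e, f (w + e) ∂noiseLaw ε =
      (2 * ε)⁻¹ * ∫ s in Set.Icc (-3 : ℝ) 3, window ε (s - w) * f s := by
  rw [noiseLaw_eq hε, integral_smul_measure, ENNReal.toReal_ofReal (by positivity), smul_eq_mul,
    ← integral_indicator measurableSet_Icc, ← integral_indicator measurableSet_Icc,
    ← integral_add_left_eq_self
      ((Set.Icc (-3 : ℝ) 3).indicator fun s => window ε (s - w) * f s) w]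
  congr 2 with e
  rw [abs_le] at hw
  simp only [Set.indicator_apply, Set.mem_Icc, window, add_sub_cancel_left]
  by_cases h : |e| ≤ ε
  · have h' := abs_le.1 h
    rw [if_pos h', if_pos h, if_pos ⟨by linarith, by linarith⟩, one_mul]
  · rw [if_neg (fun h' => h (abs_le.2 h')), if_neg h, zero_mul, ite_self]

lemma lintegral_noiseLaw {ε : ℝ} (hε : 0 < ε) (w : ℝ) (f : ℝ → ℝ≥0∞) :
    ∫⁻ e, f (w + e) ∂noiseLaw ε =
      ∫⁻ s, ENNReal.ofReal ((2 * ε)⁻¹ * window ε (s - w)) * f s := by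
  rw [noiseLaw_eq hε, lintegral_smul_measure, smul_eq_mul, ← lintegral_indicator measurableSet_Icc,
    ← lintegral_const_mul' _ _ ENNReal.ofReal_ne_top,
    ← lintegral_add_left_eq_self
      (fun s => ENNReal.ofReal ((2 * ε)⁻¹ * window ε (s - w)) * f s) w]
  congr 1 with e
  simp only [Set.indicator_apply, Set.mem_Icc, window, add_sub_cancel_left, ← abs_le]
  split_ifs <;> simp

/-! ### The strategy profile and its payoffs -/

/-- Experts report the state; the quacks randomize uniformly over `[-b, b]` and `[-1, 1]`. -/
noncomputable def truthful (b : ℝ) (hb0 : 0 < b) (hb : b ≤ 1) : Messaging where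
  expert _ := Kernel.id
  quack i := if i = 0 then uniformMsg b else uniformMsg 1
  expert_markov _ := inferInstance
  quack_prob i := by
    split_ifs
    exacts [isProbabilityMeasure_uniformMsg hb0 hb, isProbabilityMeasure_uniformMsg one_pos le_rfl]

/-- The selection rule that selects speaker 1 with probability `accept`. -/
noncomputable def acceptRule (ε b : ℝ) : SpeakerRule where
  first x := accept ε b x.1.1 x.1.2 x.2
  measurable_first := (measurable_accept ε b).comp
    (f := fun x : (Msg × Msg) × ℝ => (((x.1.1 : ℝ), (x.1.2 : ℝ)), x.2)) (by fun_prop)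
  first_nonneg _ := accept_nonneg _ _ _ _ _
  first_le_one _ := accept_le_one _ _ _ _ _

lemma abs_msg_le (m : Msg) : |(m : ℝ)| ≤ 1 := abs_le.2 m.2

lemma expertPayoff_zero {ε b : ℝ} (hε : 0 < ε) (hε1 : ε < 1) (hb0 : 0 < b)
    (hb : b < 1) (w m : Msg) :
    expertPayoff ε (truthful b hb0 hb.le) (acceptRule ε b) 0 w m =
      (2 * ε)⁻¹ * ((2 * 1)⁻¹ * expertGain ε b w m) := by
  have h : ∀ s, ∫ m', (acceptRule ε b).prob 0 (arrange 0 m m', s)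
      ∂((truthful b hb0 hb.le).quack (other 0)) =
      (2 * 1)⁻¹ * ∫ v in Set.Icc (-1 : ℝ) 1, accept ε b m v s := fun s =>
    integral_uniformMsg one_pos le_rfl fun v => accept ε b m v s
  unfold expertPayoff expertGain
  simp_rw [h]
  rw [integral_noiseLaw hε hε1 (abs_msg_le w)
    fun s => (2 * 1)⁻¹ * ∫ v in Set.Icc (-1 : ℝ) 1, accept ε b m v s]
  simp_rw [mul_left_comm (window _ _), integral_const_mul]

lemma expertPayoff_one {ε b : ℝ} (hε : 0 < ε) (hε1 : ε < 1) (hb0 : 0 < b)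
    (hb : b < 1) (w m : Msg) :
    expertPayoff ε (truthful b hb0 hb.le) (acceptRule ε b) 1 w m =
      (2 * ε)⁻¹ * ((2 * b)⁻¹ * expertGain' ε b w m) := by
  have h : ∀ s, ∫ m', (acceptRule ε b).prob 1 (arrange 1 m m', s)
      ∂((truthful b hb0 hb.le).quack (other 1)) =
      (2 * b)⁻¹ * ∫ u in Set.Icc (-b) b, (1 - accept ε b u m s) := fun s =>
    integral_uniformMsg hb0 hb.le fun u => 1 - accept ε b u m s
  unfold expertPayoff expertGain'
  simp_rw [h]
  rw [integral_noiseLaw hε hε1 (abs_msg_le w)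
    fun s => (2 * b)⁻¹ * ∫ u in Set.Icc (-b) b, (1 - accept ε b u m s)]
  simp_rw [mul_left_comm (window _ _), integral_const_mul]

lemma quackPayoff_zero {ε b : ℝ} (hε : 0 < ε) (hε1 : ε < 1) (hb0 : 0 < b)
    (hb : b < 1) (m : Msg) :
    quackPayoff ε (truthful b hb0 hb.le) (acceptRule ε b) 0 m =
      (2 * 1)⁻¹ * ((2 * ε)⁻¹ * quackGain ε b m) := by
  have h : ∀ w : Msg, ∫ e, ∫ m', (acceptRule ε b).prob 0 (arrange 0 m m', (w : ℝ) + e)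
      ∂((truthful b hb0 hb.le).expert (other 0) w) ∂(noiseLaw ε) =
      (2 * ε)⁻¹ * ∫ s in Set.Icc (-3 : ℝ) 3, window ε (s - w) * accept ε b m w s := fun w => by
    rw [← integral_noiseLaw hε hε1 (abs_msg_le w) fun s => accept ε b m w s]
    congr 1 with e
    exact integral_dirac _ _
  unfold quackPayoff stateLaw quackGain
  simp_rw [h]
  rw [integral_uniformMsg one_pos le_rfl fun w => (2 * ε)⁻¹ *
    ∫ s in Set.Icc (-3 : ℝ) 3, window ε (s - w) * accept ε b m w s, integral_const_mul]

lemma quackPayoff_one {ε b : ℝ} (hε : 0 < ε) (hε1 : ε < 1) (hb0 : 0 < b)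
    (hb : b < 1) (m : Msg) :
    quackPayoff ε (truthful b hb0 hb.le) (acceptRule ε b) 1 m =
      (2 * 1)⁻¹ * ((2 * ε)⁻¹ * ∫ τ in Set.Icc 0 b, layer ε τ * τ) := by
  have h : ∀ w : Msg, ∫ e, ∫ m', (acceptRule ε b).prob 1 (arrange 1 m m', (w : ℝ) + e)
      ∂((truthful b hb0 hb.le).expert (other 1) w) ∂(noiseLaw ε) =
      (2 * ε)⁻¹ * ∫ s in Set.Icc (-3 : ℝ) 3, window ε (s - w) * (1 - accept ε b w m s) :=
    fun w => by
      rw [← integral_noiseLaw hε hε1 (abs_msg_le w) fun s => 1 - accept ε b w m s]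
      congr 1 with e
      exact integral_dirac _ _
  rw [← integral_window_mul_one_sub_accept hε hε1 hb (abs_msg_le m)]
  unfold quackPayoff stateLaw
  simp_rw [h]
  rw [integral_uniformMsg one_pos le_rfl fun w => (2 * ε)⁻¹ *
    ∫ s in Set.Icc (-3 : ℝ) 3, window ε (s - w) * (1 - accept ε b w m s), integral_const_mul]

lemma expertPayoff_le {ε b : ℝ} (hε : 0 < ε) (hε1 : ε < 1) (hb0 : 0 < b)
    (hb : b < 1) (i : Fin 2) (w m : Msg) :
    expertPayoff ε (truthful b hb0 hb.le) (acceptRule ε b) i w m ≤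
      expertPayoff ε (truthful b hb0 hb.le) (acceptRule ε b) i w w := by
  fin_cases i
  · simp only [Fin.zero_eta, expertPayoff_zero hε hε1 hb0 hb]
    have := expertGain_le hε hε1 hb0.le hb (w := w) (abs_msg_le m)
    gcongr
  · simp only [Fin.mk_one, expertPayoff_one hε hε1 hb0 hb]
    have := expertGain'_le hε hε1 hb (abs_msg_le w) (abs_msg_le m)
    gcongr

lemma quackPayoff_le {ε b : ℝ} (hε : 0 < ε) (hε1 : ε < 1) (hb0 : 0 < b)
    (hb : b < 1) (i : Fin 2) (m : Msg) :
    quackPayoff ε (truthful b hb0 hb.le) (acceptRule ε b) i m ≤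
      ∫ m', quackPayoff ε (truthful b hb0 hb.le) (acceptRule ε b) i m'
        ∂((truthful b hb0 hb.le).quack i) := by
  have hp := (truthful b hb0 hb.le).quack_prob
  fin_cases i
  · have := hp 0
    simp only [Fin.zero_eta, quackPayoff_zero hε hε1 hb0 hb]
    have h : ∀ᵐ m' : Msg ∂((truthful b hb0 hb.le).quack 0),
        (2 * 1)⁻¹ * ((2 * ε)⁻¹ * quackGain ε b m') =
          (2 * 1)⁻¹ * ((2 * ε)⁻¹ * overlap ε b) := by
      change ∀ᵐ m' : Msg ∂(uniformMsg b), _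
      rw [uniformMsg_eq hb0 hb.le]
      refine Measure.ae_smul_measure ?_ _
      refine (ae_restrict_iff' (measurableSet_abs_le_msg b)).2 (.of_forall fun m' hm => ?_)
      rw [quackGain_of_abs_le hε hε1 hb hm]
    rw [integral_congr_ae h, integral_const, probReal_univ, one_smul]
    have := quackGain_le hε hε1 hb0.le hb (abs_msg_le m)
    gcongr
  · have := hp 1
    simp only [Fin.mk_one, quackPayoff_one hε hε1 hb0 hb]
    rw [integral_const, probReal_univ, one_smul]

/-! ### Beliefs and the judge's optimality -/

/-- The belief system in which speaker 1 is believed to be the expert with the prior odds if both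
messages are consistent with the signal, and an inconsistent message of speaker 1 exposes him. -/
noncomputable def belief (ε b p₁ p₂ : ℝ) (hb0 : 0 < b) (hp₁ : 0 < p₁) (hp₂ : 0 < p₂) :
    SpeakerRule where
  first x := if |x.2 - x.1.1| ≤ ε then
    (if |(x.1.1 : ℝ)| ≤ b ∧ |x.2 - x.1.2| ≤ ε then p₁ / (p₁ + p₂ / b) else 1) else 0
  measurable_first := by
    have h1 : MeasurableSet {x : (Msg × Msg) × ℝ | |x.2 - x.1.1| ≤ ε} :=
      measurableSet_le (by fun_prop) (by fun_prop)
    have h2 : MeasurableSet {x : (Msg × Msg) × ℝ | |(x.1.1 : ℝ)| ≤ b} :=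
      measurableSet_le (by fun_prop) (by fun_prop)
    have h3 : MeasurableSet {x : (Msg × Msg) × ℝ | |x.2 - x.1.2| ≤ ε} :=
      measurableSet_le (by fun_prop) (by fun_prop)
    exact Measurable.ite h1 (Measurable.ite (h2.inter h3) measurable_const measurable_const)
      measurable_const
  first_nonneg x := by split_ifs <;> positivity
  first_le_one x := by
    split_ifs
    · exact (div_le_one (by positivity)).2 (by linarith [div_pos hp₂ hb0])
    · rfl
    · exact zero_le_one

lemma judge_optimal {ε b p₁ p₂ : ℝ} (hb0 : 0 < b) (hb1 : b < 1) (hp₁ : 0 < p₁) (hp₂ : 0 < p₂)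
    (hb : b = max (p₂ / p₁) (1 - 2 * ε)) (x : (Msg × Msg) × ℝ) (i : Fin 2)
    (hi : 0 < (acceptRule ε b).prob i x) (j : Fin 2) :
    (belief ε b p₁ p₂ hb0 hp₁ hp₂).prob j x ≤ (belief ε b p₁ p₂ hb0 hp₁ hp₂).prob i x := by
  have hle : p₂ / b ≤ p₁ := by
    rw [div_le_iff₀ hb0, ← div_le_iff₀' hp₁, hb]
    exact le_max_left _ _
  have hq : 0 < p₂ / b := by positivity
  have key1 : 0 < accept ε b x.1.1 x.1.2 x.2 →
      1 / 2 ≤ (belief ε b p₁ p₂ hb0 hp₁ hp₂).first x := fun h => by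
    simp only [belief]
    split_ifs with h1 h2
    · rw [div_le_div_iff₀ two_pos (by positivity)]; linarith
    · norm_num
    · simp [accept, window, h1] at h
  have key2 : 0 < 1 - accept ε b x.1.1 x.1.2 x.2 →
      (belief ε b p₁ p₂ hb0 hp₁ hp₂).first x ≤ 1 / 2 := fun h => by
    simp only [belief]
    split_ifs with h1 h2
    -- Speaker 2 may be selected here only at a tie, `b = p₂ / p₁`; when `b = 1 - 2 * ε` the share
    -- is zero, contradicting `h`.
    · rcases max_choice (p₂ / p₁) (1 - 2 * ε) with h3 | h3 <;> rw [h3] at hb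
      · rw [div_le_div_iff₀ (by positivity) two_pos]
        have : p₂ / b = p₁ := by rw [hb]; field_simp
        linarith
      · rw [accept, share_eq_zero (transport_eq_zero hb.le hb1 (abs_msg_le _)), window,
          if_pos h1] at h
        simp at h
    · have : share ε b x.1.1 x.1.2 * window ε (x.2 - x.1.2) = 0 := by
        by_cases h3 : |(x.1.1 : ℝ)| ≤ b
        · simp [window, show ¬ |x.2 - x.1.2| ≤ ε from fun h4 => h2 ⟨h3, h4⟩]
        · rw [share_eq_zero (transport_eq_zero_of_lt ε (abs_msg_le _) (not_le.1 h3)), zero_mul]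
      rw [accept, this, window, if_pos h1] at h
      simp at h
    · norm_num
  fin_cases i <;> fin_cases j <;> simp [SpeakerRule.prob, acceptRule] at hi ⊢
  · linarith [key1 hi]
  · linarith [key2 (sub_pos.2 hi)]

/-! ### Outcome densities and Bayes' rule -/

lemma lintegral_outcomeLaw {ε b : ℝ} (hε : 0 < ε) (hb0 : 0 < b) (hb : b ≤ 1) (i : Fin 2)
    {f : (Msg × Msg) × ℝ → ℝ≥0∞} (hf : Measurable f) :
    ∫⁻ x, f x ∂outcomeLaw ε (truthful b hb0 hb) i =
      ∫⁻ w, ∫⁻ m, ∫⁻ e, f (arrange i w m, (w : ℝ) + e) ∂(noiseLaw ε)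
        ∂((truthful b hb0 hb).quack (other i)) ∂stateLaw := by
  have h1 := isProbabilityMeasure_noiseLaw hε
  have h2 := (truthful b hb0 hb).quack_prob (other i)
  have h3 : IsProbabilityMeasure stateLaw := isProbabilityMeasure_uniformMsg one_pos le_rfl
  have h4 := (truthful b hb0 hb).expert_markov i
  have ha : Measurable fun x : Msg × Msg => arrange i x.1 x.2 := by
    unfold arrange; split_ifs <;> fun_prop
  have hg : Measurable fun x : ((Msg × Msg) × Msg) × ℝ =>
      (arrange i x.1.1.2 x.1.2, (x.1.1.1 : ℝ) + x.2) :=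
    (ha.comp (f := fun x : ((Msg × Msg) × Msg) × ℝ => (x.1.1.2, x.1.2)) (by fun_prop)).prodMk
      (by fun_prop)
  have hfg : Measurable fun x : ((Msg × Msg) × Msg) × ℝ =>
      f (arrange i x.1.1.2 x.1.2, (x.1.1.1 : ℝ) + x.2) := hf.comp hg
  unfold outcomeLaw
  rw [lintegral_map hf hg, lintegral_prod _ hfg.aemeasurable,
    lintegral_prod _ hfg.lintegral_prod_right'.aemeasurable,
    Measure.lintegral_compProd hfg.lintegral_prod_right'.lintegral_prod_right']
  congr 1 with w
  exact lintegral_dirac _ _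

/-- The density of the outcome if speaker 1 is the expert. -/
noncomputable def density₁ (ε : ℝ) (x : (Msg × Msg) × ℝ) : ℝ :=
  (2 * 1)⁻¹ * ((2 * 1)⁻¹ * ((2 * ε)⁻¹ * window ε (x.2 - x.1.1)))

/-- The density of the outcome if speaker 2 is the expert. -/
noncomputable def density₂ (ε b : ℝ) (x : (Msg × Msg) × ℝ) : ℝ :=
  (2 * 1)⁻¹ * (((2 * b)⁻¹ * if |(x.1.1 : ℝ)| ≤ b then 1 else 0) *
    ((2 * ε)⁻¹ * window ε (x.2 - x.1.2)))

lemma measurable_density₁ (ε : ℝ) : Measurable (density₁ ε) := by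
  have := measurable_window ε
  unfold density₁; fun_prop

lemma measurable_density₂ (ε b : ℝ) : Measurable (density₂ ε b) := by
  have := measurable_window ε
  have h2 : MeasurableSet {x : (Msg × Msg) × ℝ | |(x.1.1 : ℝ)| ≤ b} :=
    measurableSet_le (by fun_prop) (by fun_prop)
  have h3 : Measurable fun x : (Msg × Msg) × ℝ => if |(x.1.1 : ℝ)| ≤ b then (1 : ℝ) else 0 :=
    Measurable.ite h2 measurable_const measurable_const
  unfold density₂; fun_prop

lemma lintegral_uniformMsg {c : ℝ} (hc0 : 0 < c) (hc : c ≤ 1) (f : Msg → ℝ≥0∞) :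
    ∫⁻ m, f m ∂uniformMsg c = ∫⁻ m,
      ENNReal.ofReal ((2 * c)⁻¹ * if |(m : ℝ)| ≤ c then 1 else 0) * f m ∂msgVolume := by
  rw [uniformMsg_eq hc0 hc, lintegral_smul_measure, smul_eq_mul,
    ← lintegral_indicator (measurableSet_abs_le_msg c),
    ← lintegral_const_mul' _ _ ENNReal.ofReal_ne_top]
  congr 1 with m
  simp only [Set.indicator_apply, Set.mem_ofPred_eq]
  split_ifs <;> simp

lemma lintegral_uniformMsg_one (f : Msg → ℝ≥0∞) :
    ∫⁻ m, f m ∂uniformMsg 1 = ∫⁻ m, ENNReal.ofReal (2 * 1)⁻¹ * f m ∂msgVolume := by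
  rw [lintegral_uniformMsg one_pos le_rfl]
  simp only [abs_msg_le, if_true, mul_one]

lemma outcomeLaw_zero {ε b : ℝ} (hε : 0 < ε) (hb0 : 0 < b) (hb : b ≤ 1) :
    outcomeLaw ε (truthful b hb0 hb) 0 =
      ((msgVolume.prod msgVolume).prod volume).withDensity
        fun x => ENNReal.ofReal (density₁ ε x) := by
  have hd := (measurable_density₁ ε).ennreal_ofReal
  refine Measure.ext_of_lintegral _ fun f hf => ?_
  have hm := hd.mul hf
  rw [lintegral_outcomeLaw hε hb0 hb 0 hf, lintegral_withDensity_eq_lintegral_mul _ hd hf,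
    lintegral_prod _ hm.aemeasurable, lintegral_prod _ hm.lintegral_prod_right'.aemeasurable,
    stateLaw, lintegral_uniformMsg_one]
  congr 1 with w
  rw [← lintegral_const_mul' _ _ ENNReal.ofReal_ne_top]
  change ∫⁻ m, _ ∂(uniformMsg 1) = _
  rw [lintegral_uniformMsg_one]
  congr 1 with m
  rw [lintegral_noiseLaw hε w fun s => f (arrange 0 w m, s),
    ← lintegral_const_mul' _ _ ENNReal.ofReal_ne_top,
    ← lintegral_const_mul' _ _ ENNReal.ofReal_ne_top]
  congr 1 with s
  simp only [Pi.mul_apply, density₁, arrange, if_true]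
  rw [ENNReal.ofReal_mul (p := (2 * 1)⁻¹) (by positivity),
    ENNReal.ofReal_mul (p := (2 * 1)⁻¹) (by positivity)]
  ring

lemma outcomeLaw_one {ε b : ℝ} (hε : 0 < ε) (hb0 : 0 < b) (hb : b ≤ 1) :
    outcomeLaw ε (truthful b hb0 hb) 1 =
      ((msgVolume.prod msgVolume).prod volume).withDensity
        fun x => ENNReal.ofReal (density₂ ε b x) := by
  have hd := (measurable_density₂ ε b).ennreal_ofReal
  refine Measure.ext_of_lintegral _ fun f hf => ?_
  have hm := hd.mul hf
  rw [lintegral_outcomeLaw hε hb0 hb 1 hf, lintegral_withDensity_eq_lintegral_mul _ hd hf,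
    -- The state is now the second message, so the outer integral must run over the second
    -- coordinate.
    lintegral_prod _ hm.aemeasurable, lintegral_prod_symm _ hm.lintegral_prod_right'.aemeasurable,
    stateLaw, lintegral_uniformMsg_one]
  congr 1 with w
  rw [← lintegral_const_mul' _ _ ENNReal.ofReal_ne_top]
  change ∫⁻ m, _ ∂(uniformMsg b) = _
  rw [lintegral_uniformMsg hb0 hb]
  congr 1 with m
  rw [lintegral_noiseLaw hε w fun s => f (arrange 1 w m, s),
    ← lintegral_const_mul' _ _ ENNReal.ofReal_ne_top,
    ← lintegral_const_mul' _ _ ENNReal.ofReal_ne_top]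
  congr 1 with s
  simp only [Pi.mul_apply, density₂, arrange, one_ne_zero, if_false]
  rw [ENNReal.ofReal_mul (p := (2 * 1)⁻¹) (by positivity),
    ENNReal.ofReal_mul (p := (2 * b)⁻¹ * _) (by positivity)]
  ring

/-- The densities differ only in which message must be consistent and in the factor `1 / b` on `|u|
≤ b`; where both are positive their weighted ratio is `p₁ : p₂ / b`. Where both vanish the belief is
unconstrained. -/
lemma bayes_rule {ε b p₁ p₂ : ℝ} (hε : 0 < ε) (hb0 : 0 < b) (hp₁ : 0 < p₁) (hp₂ : 0 < p₂)
    (x : (Msg × Msg) × ℝ) :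
    p₁ * density₁ ε x = (p₁ * density₁ ε x + p₂ * density₂ ε b x) *
      (belief ε b p₁ p₂ hb0 hp₁ hp₂).first x := by
  simp only [density₁, density₂, belief, window]
  by_cases h1 : |x.2 - x.1.1| ≤ ε
  · by_cases h2 : |(x.1.1 : ℝ)| ≤ b
    · by_cases h3 : |x.2 - x.1.2| ≤ ε
      · have : 0 < p₁ + p₂ / b := by positivity
        rw [if_pos h1, if_pos h1, if_pos h2, if_pos h3, if_pos ⟨h2, h3⟩, mul_div_assoc',
          eq_div_iff this.ne']
        field_simp
      · simp [h3, h1]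
    · simp [h1, h2]
  · simp [h1]

lemma bayesConsistent {ε b p₁ p₂ : ℝ} (hε : 0 < ε) (hb0 : 0 < b) (hb : b ≤ 1) (hp₁ : 0 < p₁)
    (hp₂ : 0 < p₂) :
    BayesConsistent ε ![p₁, p₂] (truthful b hb0 hb) (belief ε b p₁ p₂ hb0 hp₁ hp₂) := by
  intro i B hB
  have hd₁ := (measurable_density₁ ε).ennreal_ofReal
  have hd₂ := (measurable_density₂ ε b).ennreal_ofReal
  have hβ : Measurable fun x => ENNReal.ofReal ((belief ε b p₁ p₂ hb0 hp₁ hp₂).prob i x) := by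
    have := (belief ε b p₁ p₂ hb0 hp₁ hp₂).measurable_first
    unfold SpeakerRule.prob
    split_ifs <;> fun_prop
  simp only [Matrix.cons_val_zero, Matrix.cons_val_one]
  rw [outcomeLaw_zero hε, outcomeLaw_one hε, ← withDensity_smul _ hd₁, ← withDensity_smul _ hd₂,
    ← withDensity_add_left (hd₁.const_smul _),
    setLIntegral_withDensity_eq_setLIntegral_mul _ ((hd₁.const_smul _).add (hd₂.const_smul _))
      hβ hB]
  have hn₁ : ∀ x, 0 ≤ density₁ ε x := fun x => by
    have := window_nonneg ε (x.2 - x.1.1)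
    unfold density₁; positivity
  have hn₂ : ∀ x, 0 ≤ density₂ ε b x := fun x => by
    have := window_nonneg ε (x.2 - x.1.2)
    unfold density₂; positivity
  have hbayes := bayes_rule hε hb0 hp₁ hp₂
  have hs : ∀ x, ENNReal.ofReal p₁ * ENNReal.ofReal (density₁ ε x) +
      ENNReal.ofReal p₂ * ENNReal.ofReal (density₂ ε b x) =
      ENNReal.ofReal (p₁ * density₁ ε x + p₂ * density₂ ε b x) := fun x => by
    rw [ENNReal.ofReal_add (mul_nonneg hp₁.le (hn₁ x)) (mul_nonneg hp₂.le (hn₂ x)),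
      ENNReal.ofReal_mul hp₁.le, ENNReal.ofReal_mul hp₂.le]
  have ht : ∀ x, 0 ≤ p₁ * density₁ ε x + p₂ * density₂ ε b x := fun x =>
    add_nonneg (mul_nonneg hp₁.le (hn₁ x)) (mul_nonneg hp₂.le (hn₂ x))
  fin_cases i
  · simp only [Fin.zero_eta, Matrix.cons_val_zero]
    rw [outcomeLaw_zero hε, withDensity_apply _ hB, ← lintegral_const_mul _ hd₁]
    congr 1 with x
    simp only [Pi.mul_apply, Pi.add_apply, Pi.smul_apply, smul_eq_mul, SpeakerRule.prob, if_true]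
    rw [hs, ← ENNReal.ofReal_mul (ht x), ← hbayes, ENNReal.ofReal_mul hp₁.le]
  · simp only [Fin.mk_one, Matrix.cons_val_one]
    rw [outcomeLaw_one hε, withDensity_apply _ hB]
    simp only [Matrix.cons_val_fin_one]
    rw [← lintegral_const_mul _ hd₂]
    congr 1 with x
    simp only [Pi.mul_apply, Pi.add_apply, Pi.smul_apply, smul_eq_mul, SpeakerRule.prob,
      one_ne_zero, if_false]
    rw [hs, ← ENNReal.ofReal_mul (ht x), mul_sub, ← hbayes, mul_one, add_sub_cancel_left,
      ENNReal.ofReal_mul hp₂.le]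

lemma isPBE {ε b p₁ p₂ : ℝ} (hε : 0 < ε) (hε1 : ε < 1) (hb0 : 0 < b) (hb1 : b < 1) (hp₁ : 0 < p₁)
    (hp₂ : 0 < p₂) (hb : b = max (p₂ / p₁) (1 - 2 * ε)) :
    IsPBE ε ![p₁, p₂] (truthful b hb0 hb1.le) (acceptRule ε b)
      (belief ε b p₁ p₂ hb0 hp₁ hp₂) where
  expert_optimal i w m :=
    (expertPayoff_le hε hε1 hb0 hb1 i w m).trans_eq (integral_dirac _ _).symm
  quack_optimal := quackPayoff_le hε hε1 hb0 hb1
  bayes := bayesConsistent hε hb0 hb1.le hp₁ hp₂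
  judge_optimal := judge_optimal hb0 hb1 hp₁ hp₂ hb

end QuackGame

/-- `p₁`, `p₂` are the prior probabilities that speaker 1, respectively 2, is the expert; exactly
one of them is. Speaker 1 is the favored one. -/
theorem mainTheorem9 (ε p₁ p₂ : ℝ) (hε : 0 < ε) (hε1 : ε < 1)
    (hp₁ : p₁ ∈ Set.Ioo (0 : ℝ) 1) (hp₂ : p₂ ∈ Set.Ioo (0 : ℝ) 1) (hsum : p₁ + p₂ = 1)
    (hfav : 1 / 2 < p₁) (hdis : p₂ < 1 / 2) :
    ∃ mbar : ℝ, mbar = max (p₂ / p₁) (1 - 2 * ε) ∧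
      0 < mbar ∧ mbar ∈ Set.Icc (1 - 2 * ε) 1 ∧
      (p₁ ≤ 1 / (2 - 2 * ε) → mbar = p₂ / p₁) ∧
      (mbar = 1 - 2 * ε ↔ 1 / (2 - 2 * ε) ≤ p₁) ∧
      ∃ (σ : QuackGame.Messaging) (φ β : QuackGame.SpeakerRule),
        QuackGame.IsPBE ε ![p₁, p₂] σ φ β ∧
        (∀ (i : Fin 2) (ω : QuackGame.Msg), σ.expert i ω = MeasureTheory.Measure.dirac ω) ∧
        σ.quack 1 = QuackGame.uniformMsg 1 ∧
        σ.quack 0 = QuackGame.uniformMsg mbar := by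
  have hq : p₂ / p₁ < 1 := (div_lt_one hp₁.1).2 (by linarith)
  have hb0 : 0 < max (p₂ / p₁) (1 - 2 * ε) := lt_max_of_lt_left (div_pos hp₂.1 hp₁.1)
  have hb1 : max (p₂ / p₁) (1 - 2 * ε) < 1 := max_lt hq (by linarith)
  have hpos : 0 < 2 - 2 * ε := by linarith
  refine ⟨_, rfl, hb0, ⟨le_max_right _ _, hb1.le⟩, fun h => max_eq_left ?_, ?_,
    QuackGame.truthful _ hb0 hb1.le, QuackGame.acceptRule ε _, _,
    QuackGame.isPBE hε hε1 hb0 hb1 hp₁.1 hp₂.1 rfl, fun i ω => ?_, rfl, rfl⟩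
  -- With `p₂ = 1 - p₁`, `1 - 2 * ε ≤ p₂ / p₁` is the same as `p₁ * (2 - 2 * ε) ≤ 1`.
  · rw [le_div_iff₀ hpos] at h
    rw [le_div_iff₀ hp₁.1]
    linarith
  · rw [max_eq_right_iff, div_le_iff₀ hp₁.1, div_le_iff₀ hpos]
    constructor <;> intro h <;> linarith
  · exact ProbabilityTheory.Kernel.id_apply ω
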